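/- Let $1\le p<\infty$, let $(\Omega,\Sigma,\mu)$ be a finite measure space and let $V\subset L^1(\mu)_+$ be relatively weakly compact. All scalars are real. For a Banach space $E$ and a countably additive vector measure $m:\Xi\to E$ on a measurable space $(\Lambda,\Xi)$, a set $A\in\Xi$ is $m$-null if $m(B)=0$ for every $B\in\Xi$, $B\subseteq A$. The space $L^1(m)$ consists of the measurable functions $f$ (modulo equality $m$-a.e.) that are integrable with respect to each scalar measure $\langle m,x^*\rangle$, $x^*\in E^*$, and such that for each $A\in\Xi$ there is $\int_A f\,dm\in E$ with $\langle\int_A f\,dm,x^*\rangle=\int_A f\,d\langle m,x^*\rangle$ for all $x^*\in E^*$; its norm is $\|f\|_{L^1(m)}=\sup_{\|x^*\|\le 1}\int|f|\,d|\langle m,x^*\rangle|$. Further, $L^p(m)=\{f:|f|^p\in L^1(m)\}$ with $\|f\|_{L^p(m)}=\||f|^p\|_{L^1(m)}^{1/p}$, and $I_m(f)=\int f\,dm$. Let $m_V:\Sigma\to\ell^\infty(V)$ be the vector measure $m_V(A)=(\int_A v\,d\mu)_{v\in V}$, let $m:\Xi\to L^p(m_V)$ be a countably additive vector measure, and let $\nu$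 be a control measure for $m$, that is, a finite positive measure on $\Xi$ with $m\ll\nu$ (in particular, any finite measure with the same null sets as $m$). The following are equivalent. (i) The integration map $I_m:L^p(m)\to L^p(m_V)$ is $p$-regular: there is $K>0$ such that for all $n$ and all $f_1,\dots,f_n\in L^p(m)$, $$\Big\|\Big(\sum_{i=1}^n|I_m f_i|^p\Big)^{1/p}\Big\|_{L^p(m_V)}\le K\,\Big\|\Big(\sum_{i=1}^n|f_i|^p\Big)^{1/p}\Big\|_{L^p(m)}.$$ (ii) There is a set $W\subset B_{(L^1(m))'}$ that is a conjugate family of weights for $V$ with respect to $I_m$. Here $B_{(L^1(m))'}$ is the closed unit ball of the Köthe dual of $L^1(m)$ with respect to $\nu$: the set of classes $g\in L^0(\nu)$ such that $fg\in L^1(\nu)$ for every measurable $f\in L^1(m)$, and $\int fg\,d\nu\le 1$ whenever moreover $\|f\|_{L^1(m)}\le 1$. A set $W\subset L^1(\nu)_+$ is a conjugate family of weights for $V$ with respect to $I_m$ if there is a constant $C$ such that for every $w\in W$ the formal identity $i_w:L^p(m)\to L^p(w\,d\nu)$ is well defined and bounded with $\|i_w\|\le C$, and for every $v\in V$ there is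 $w\in W$ such that $I_m$ induces a bounded operator $S:L^p(w\,d\nu)\to L^p(v\,d\mu)$ with $\|S\|\le C$ (that is, $S(i_w f)=I_m f$ in $L^p(v\,d\mu)$ for all $f\in L^p(m)$). -/

import Mathlib

open MeasureTheory Filter Topology
open scoped ENNReal NNReal

noncomputable section

namespace VectorLp

section General

variable {Ω : Type*} [MeasurableSpace Ω] {E : Type*} [NormedAddCommGroup E] [NormedSpace ℝ E]

/-- The scalar measure `⟨m, ℓ⟩ : A ↦ ℓ (m A)`. -/
def scal (m : VectorMeasure Ω E) (ℓ : StrongDual ℝ E) : SignedMeasure Ω :=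
  m.mapRange (ℓ : E →+ ℝ) ℓ.continuous

/-- `f ∈ L¹(m)`: `f` is measurable (modulo `m`-null sets), integrable with respect to each `⟨m, ℓ⟩`,
and for each measurable `A` there is `∫_A f dm ∈ E` with `ℓ (∫_A f dm) = ∫_A f d⟨m, ℓ⟩` for all `ℓ`.
The null sets of the (possibly infinite) measure `m.variation` are the `m`-null sets. -/
def MemL1 (m : VectorMeasure Ω E) (f : Ω → ℝ) : Prop :=
  AEStronglyMeasurable f m.variation ∧
    (∀ ℓ : StrongDual ℝ E, Integrable f (scal m ℓ).variation) ∧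
    ∀ A, MeasurableSet A → ∃ e : E, ∀ ℓ : StrongDual ℝ E, ℓ e = ∫ᵛ x in A, f x ∂<•(scal m ℓ)

/-- `f ∈ L^p(m)`, for `1 ≤ p < ∞`: `f` is measurable and `|f|^p ∈ L¹(m)`. -/
def MemLp (m : VectorMeasure Ω E) (p : ℝ≥0) (f : Ω → ℝ) : Prop :=
  AEStronglyMeasurable f m.variation ∧ MemL1 m (fun x => |f x| ^ (p : ℝ))

/-- The extended norm `sup_{‖ℓ‖ ≤ 1} (∫ |f|^p d|⟨m, ℓ⟩|)^{1/p}` of `L^p(m)`. -/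
def eNormLp (m : VectorMeasure Ω E) (p : ℝ≥0) (f : Ω → ℝ) : ℝ≥0∞ :=
  ⨆ ℓ ∈ {ℓ : StrongDual ℝ E | ‖ℓ‖ ≤ 1}, eLpNorm f p (scal m ℓ).variation

variable {m : VectorMeasure Ω E} {p : ℝ≥0} {f g : Ω → ℝ}

@[simp] lemma scal_apply (ℓ : StrongDual ℝ E) (A : Set Ω) : scal m ℓ A = ℓ (m A) := rfl

lemma scal_smul (c : ℝ) (ℓ : StrongDual ℝ E) : scal m (c • ℓ) = c • scal m ℓ := by
  ext A _
  simp

instance (s : SignedMeasure Ω) : IsFiniteMeasure s.variation := by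
  rw [← SignedMeasure.totalVariation_eq_variation]; infer_instance

lemma scal_ac (m : VectorMeasure Ω E) (ℓ : StrongDual ℝ E) :
    (scal m ℓ).variation ≪ m.variation := by
  refine Measure.AbsolutelyContinuous.mk fun s hs h => ?_
  rw [VectorMeasure.variation_apply_eq_zero hs] at h ⊢
  intro t hts ht
  simp [h t hts ht]

/-- `N` is `m`-null as soon as it is null for all `⟨m, ℓ⟩`, `‖ℓ‖ ≤ 1`. -/
lemma variation_null {N : Set Ω} (hN : MeasurableSet N)
    (h : ∀ ℓ : StrongDual ℝ E, ‖ℓ‖ ≤ 1 → (scal m ℓ).variation N = 0) : m.variation N = 0 := by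
  rw [VectorMeasure.variation_apply_eq_zero hN]
  intro t hts ht
  obtain ⟨ℓ, h1, h2⟩ := exists_dual_vector'' ℝ (m t)
  have := (VectorMeasure.variation_apply_eq_zero hN).1 (h ℓ h1) t hts ht
  rw [scal_apply, h2] at this
  simpa using this

lemma eLpNorm_le_eNormLp {ℓ : StrongDual ℝ E} (h : ‖ℓ‖ ≤ 1) :
    eLpNorm f p (scal m ℓ).variation ≤ eNormLp m p f :=
  le_biSup (fun ℓ : StrongDual ℝ E => eLpNorm f p (scal m ℓ).variation) h

lemma eNormLp_le {C : ℝ≥0∞}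
    (h : ∀ ℓ : StrongDual ℝ E, ‖ℓ‖ ≤ 1 → eLpNorm f p (scal m ℓ).variation ≤ C) :
    eNormLp m p f ≤ C :=
  iSup₂_le h

lemma eNormLp_congr (h : f =ᵐ[m.variation] g) : eNormLp m p f = eNormLp m p g := by
  unfold eNormLp
  congr! 3 with ℓ
  exact eLpNorm_congr_ae ((scal_ac m ℓ).ae_eq h)

lemma ae_eq_zero_of_eNormLp (hp : p ≠ 0) (hf : AEStronglyMeasurable f m.variation)
    (h : eNormLp m p f = 0) : f =ᵐ[m.variation] 0 := by
  have h1 : f =ᵐ[m.variation] hf.mk f := hf.ae_eq_mk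
  refine h1.trans ?_
  have hm := hf.stronglyMeasurable_mk.measurable
  have : m.variation {x | hf.mk f x ≠ 0} = 0 := by
    refine variation_null (hm (measurableSet_singleton 0).compl) fun ℓ hℓ => ?_
    have h2 := eLpNorm_le_eNormLp (m := m) (p := p) (f := hf.mk f) hℓ
    rw [← eNormLp_congr h1, h, nonpos_iff_eq_zero,
      eLpNorm_eq_zero_iff hf.stronglyMeasurable_mk.aestronglyMeasurable (by simpa using hp)] at h2
    exact h2
  exact this

lemma eNormLp_add_le (hp : 1 ≤ (p : ℝ≥0∞)) (hf : AEStronglyMeasurable f m.variation)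
    (hg : AEStronglyMeasurable g m.variation) :
    eNormLp m p (f + g) ≤ eNormLp m p f + eNormLp m p g :=
  eNormLp_le fun ℓ hℓ => (eLpNorm_add_le (hf.mono_ac (scal_ac m ℓ)) (hg.mono_ac (scal_ac m ℓ))
    hp).trans (add_le_add (eLpNorm_le_eNormLp hℓ) (eLpNorm_le_eNormLp hℓ))

lemma eNormLp_smul (c : ℝ) : eNormLp m p (c • f) = ‖c‖ₑ * eNormLp m p f := by
  unfold eNormLp
  rw [ENNReal.mul_iSup]
  refine iSup_congr fun ℓ => ?_
  rw [ENNReal.mul_iSup]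
  exact iSup_congr fun _ => eLpNorm_const_smul c f p _

lemma eNormLp_mono (h : ∀ᵐ x ∂m.variation, |f x| ≤ |g x|) : eNormLp m p f ≤ eNormLp m p g :=
  eNormLp_le fun ℓ hℓ => by
    have h' : ∀ᵐ x ∂(scal m ℓ).variation, ‖f x‖ ≤ ‖g x‖ := h.filter_mono (scal_ac m ℓ).ae_le
    exact (eLpNorm_mono_ae h').trans (eLpNorm_le_eNormLp hℓ)

/-- `‖ |f|^p ‖_{L¹(m)} = ‖f‖_{L^p(m)}^p`. -/
lemma eNormLp_rpow (hp : 0 < p) :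
    eNormLp m 1 (fun x => |f x| ^ (p : ℝ)) = eNormLp m p f ^ (p : ℝ) := by
  have hp' : (0 : ℝ) < p := by exact_mod_cast hp
  have key : ∀ ℓ : StrongDual ℝ E, eLpNorm (fun x => |f x| ^ (p : ℝ)) (1 : ℝ≥0)
      (scal m ℓ).variation = eLpNorm f p (scal m ℓ).variation ^ (p : ℝ) := fun ℓ => by
    have := eLpNorm_norm_rpow (p := 1) (μ := (scal m ℓ).variation) f hp'
    simpa using this
  apply le_antisymm
  · refine eNormLp_le fun ℓ hℓ => ?_
    rw [key]
    exact ENNReal.rpow_le_rpow (eLpNorm_le_eNormLp hℓ) hp'.le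
  · rw [← ENNReal.le_rpow_inv_iff hp']
    refine eNormLp_le fun ℓ hℓ => ?_
    rw [ENNReal.le_rpow_inv_iff hp', ← key]
    exact eLpNorm_le_eNormLp hℓ

/-- `∫ |f| d|s|` as a difference of two set integrals with respect to `s`. -/
lemma exists_sign_set (s : SignedMeasure Ω) (hf : Integrable f s.variation) :
    ∃ A, MeasurableSet A ∧
      ∫ x, |f x| ∂s.variation = (∫ᵛ x in A, f x ∂<•s) - ∫ᵛ x in Aᶜ, f x ∂<•s := by
  classical
  set P := s.toJordanDecomposition.posPart with hP
  set N := s.toJordanDecomposition.negPart with hN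
  have hvar : s.variation = P + N := by
    rw [← SignedMeasure.totalVariation_eq_variation]; rfl
  obtain ⟨u, hu, hPu, hNu⟩ := s.toJordanDecomposition.mutuallySingular
  have hfP : Integrable f P := hf.mono_measure (hvar ▸ Measure.le_add_right le_rfl)
  have hfN : Integrable f N := hf.mono_measure (hvar ▸ Measure.le_add_left le_rfl)
  have hPac : P ≪ s.variation := (hvar ▸ Measure.le_add_right le_rfl :
    P ≤ s.variation).absolutelyContinuous
  have hNac : N ≪ s.variation := (hvar ▸ Measure.le_add_left le_rfl :
    N ≤ s.variation).absolutelyContinuous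
  set f' := hf.aestronglyMeasurable.mk f
  have hff' : f =ᵐ[s.variation] f' := hf.aestronglyMeasurable.ae_eq_mk
  have hf'm : Measurable f' := hf.aestronglyMeasurable.stronglyMeasurable_mk.measurable
  have hS : MeasurableSet {x | 0 ≤ f' x} := measurableSet_le measurable_const hf'm
  set A := (uᶜ ∩ {x | 0 ≤ f' x}) ∪ (u ∩ {x | 0 ≤ f' x}ᶜ) with hA
  have hAm : MeasurableSet A := (hu.compl.inter hS).union (hu.inter hS.compl)
  refine ⟨A, hAm, ?_⟩
  have hIA : Integrable (A.indicator f) s.variation := hf.indicator hAm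
  have hIAc : Integrable (Aᶜ.indicator f) s.variation := hf.indicator hAm.compl
  rw [← VectorMeasure.integral_indicator hAm, ← VectorMeasure.integral_indicator hAm.compl,
    ← VectorMeasure.integral_fun_sub hIA hIAc]
  have hgi := hIA.sub hIAc
  have e1 : ∫ᵛ x, (A.indicator f x - Aᶜ.indicator f x) ∂<•s
      = ∫ x, (A.indicator f x - Aᶜ.indicator f x) ∂P
        - ∫ x, (A.indicator f x - Aᶜ.indicator f x) ∂N := by
    have hgP : (P.toSignedMeasure).Integrable (fun x => A.indicator f x - Aᶜ.indicator f x) := by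
      rw [VectorMeasure.Integrable, Measure.variation_toSignedMeasure]
      exact hgi.mono_measure (hvar ▸ Measure.le_add_right le_rfl)
    have hgN : (N.toSignedMeasure).Integrable (fun x => A.indicator f x - Aᶜ.indicator f x) := by
      rw [VectorMeasure.Integrable, Measure.variation_toSignedMeasure]
      exact hgi.mono_measure (hvar ▸ Measure.le_add_left le_rfl)
    conv_lhs => rw [← s.toSignedMeasure_toJordanDecomposition]
    rw [JordanDecomposition.toSignedMeasure, VectorMeasure.integral_sub_vectorMeasure hgP hgN,
      VectorMeasure.integral_toSignedMeasure, VectorMeasure.integral_toSignedMeasure]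
  have e2 : ∫ x, (A.indicator f x - Aᶜ.indicator f x) ∂P = ∫ x, |f x| ∂P := by
    apply integral_congr_ae
    have : ∀ᵐ x ∂P, x ∉ u := measure_eq_zero_iff_ae_notMem.1 hPu
    filter_upwards [this, hPac.ae_eq hff'] with x hx hx'
    by_cases h0 : 0 ≤ f' x
    · have : x ∈ A := Or.inl ⟨hx, h0⟩
      rw [hx']; simp [this, hx', abs_of_nonneg h0]
    · have : x ∉ A := by simp [A, hx, h0]
      rw [hx']; simp [this, hx', abs_of_neg (not_le.1 h0)]
  have e3 : ∫ x, (A.indicator f x - Aᶜ.indicator f x) ∂N = - ∫ x, |f x| ∂N := by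
    rw [← integral_neg]
    apply integral_congr_ae
    have : ∀ᵐ x ∂N, x ∈ u := by
      simpa using measure_eq_zero_iff_ae_notMem.1 hNu
    filter_upwards [this, hNac.ae_eq hff'] with x hx hx'
    by_cases h0 : 0 ≤ f' x
    · have : x ∉ A := by simp [A, hx, h0]
      rw [hx']; simp [this, hx', abs_of_nonneg h0]
    · have : x ∈ A := Or.inr ⟨hx, h0⟩
      rw [hx']; simp [this, hx', abs_of_neg (not_le.1 h0)]
  rw [e1, e2, e3, sub_neg_eq_add, hvar, integral_add_measure hfP.abs hfN.abs]

lemma norm_setIntegral_le {A : Set Ω} (s : SignedMeasure Ω) (hf : Integrable f s.variation) :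
    ‖∫ᵛ x in A, f x ∂<•s‖ ≤ ∫ x, |f x| ∂s.variation := by
  by_cases hA : MeasurableSet A
  · refine VectorMeasure.norm_integral_le_integral_norm.trans ?_
    rw [VectorMeasure.variation_restrict hA]
    have h1 : ‖(ContinuousLinearMap.lsmul ℝ ℝ : ℝ →L[ℝ] ℝ →L[ℝ] ℝ).flip‖ ≤ 1 := by
      rw [ContinuousLinearMap.opNorm_flip]
      exact ContinuousLinearMap.opNorm_lsmul_le
    have h2 : ∫ x in A, ‖f x‖ ∂s.variation ≤ ∫ x, |f x| ∂s.variation :=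
      setIntegral_le_integral hf.abs (Eventually.of_forall fun x => abs_nonneg _)
    calc _ ≤ 1 * ∫ x in A, ‖f x‖ ∂s.variation :=
          mul_le_mul_of_nonneg_right h1 (integral_nonneg fun _ => norm_nonneg _)
      _ ≤ _ := by rw [one_mul]; exact h2
  · rw [VectorMeasure.setIntegral_eq_zero_of_not_measurableSet hA, norm_zero]
    exact integral_nonneg fun _ => abs_nonneg _

lemma eLpNorm_one_eq {μ : Measure Ω} (hf : Integrable f μ) :
    eLpNorm f (1 : ℝ≥0) μ = ENNReal.ofReal (∫ x, |f x| ∂μ) := by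
  rw [ENNReal.coe_one, eLpNorm_one_eq_lintegral_enorm,
    ← ofReal_integral_norm_eq_lintegral_enorm hf]
  rfl

/-- The `L¹(m)`-norm is finite on `L¹(m)`. -/
lemma MemL1.eNormLp_lt_top (hf : MemL1 m f) : eNormLp m 1 f < ∞ := by
  obtain ⟨_, hint, hex⟩ := hf
  choose e he using hex
  let G : {A : Set Ω // MeasurableSet A} → StrongDual ℝ (StrongDual ℝ E) := fun A =>
    NormedSpace.inclusionInDoubleDual ℝ E (e A.1 A.2)
  obtain ⟨C, hC⟩ := banach_steinhaus (g := G) (fun ℓ => ⟨∫ x, |f x| ∂(scal m ℓ).variation,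
    fun A => by
      simp only [G, NormedSpace.dual_def]
      rw [he]
      exact norm_setIntegral_le _ (hint ℓ)⟩)
  refine lt_of_le_of_lt (eNormLp_le (C := ENNReal.ofReal (2 * C)) fun ℓ hℓ => ?_)
    ENNReal.ofReal_lt_top
  rw [eLpNorm_one_eq (hint ℓ)]
  apply ENNReal.ofReal_le_ofReal
  obtain ⟨A, hA, h⟩ := exists_sign_set _ (hint ℓ)
  rw [h, ← he A hA, ← he _ hA.compl]
  have b : ∀ A : {A : Set Ω // MeasurableSet A}, ‖ℓ (e A.1 A.2)‖ ≤ C := fun A => by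
    have h1 : ‖G A ℓ‖ ≤ ‖G A‖ * ‖ℓ‖ := (G A).le_opNorm ℓ
    have h2 : G A ℓ = ℓ (e A.1 A.2) := rfl
    rw [← h2]
    refine h1.trans ((mul_le_of_le_one_right (norm_nonneg _) hℓ).trans (hC A))
  have b1 := abs_le.1 (b ⟨A, hA⟩)
  have b2 := abs_le.1 (b ⟨Aᶜ, hA.compl⟩)
  linarith [b1.1, b1.2, b2.1, b2.2]

lemma MemL1.congr (hf : MemL1 m f) (h : f =ᵐ[m.variation] g) : MemL1 m g := by
  refine ⟨hf.1.congr h, fun ℓ => (hf.2.1 ℓ).congr ((scal_ac m ℓ).ae_eq h), fun A hA => ?_⟩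
  obtain ⟨e, he⟩ := hf.2.2 A hA
  refine ⟨e, fun ℓ => (he ℓ).trans ?_⟩
  apply VectorMeasure.setIntegral_congr_ae
  filter_upwards [(scal_ac m ℓ).ae_eq h] with x hx _ using hx

lemma MemL1.add (hf : MemL1 m f) (hg : MemL1 m g) : MemL1 m (f + g) := by
  refine ⟨hf.1.add hg.1, fun ℓ => (hf.2.1 ℓ).add (hg.2.1 ℓ), fun A hA => ?_⟩
  obtain ⟨e, he⟩ := hf.2.2 A hA
  obtain ⟨e', he'⟩ := hg.2.2 A hA
  refine ⟨e + e', fun ℓ => ?_⟩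
  have h1 : (scal m ℓ).IntegrableOn f A := VectorMeasure.Integrable.integrableOn (hf.2.1 ℓ)
  have h2 : (scal m ℓ).IntegrableOn g A := VectorMeasure.Integrable.integrableOn (hg.2.1 ℓ)
  rw [map_add, he, he']
  exact (VectorMeasure.integral_add h1 h2).symm

lemma MemL1.smul (c : ℝ) (hf : MemL1 m f) : MemL1 m (c • f) := by
  refine ⟨hf.1.const_smul c, fun ℓ => (hf.2.1 ℓ).smul c, fun A hA => ?_⟩
  obtain ⟨e, he⟩ := hf.2.2 A hA
  refine ⟨c • e, fun ℓ => ?_⟩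
  rw [map_smul, he]
  exact (VectorMeasure.integral_smul f _ _ c).symm

lemma MemL1.zero : MemL1 m (0 : Ω → ℝ) :=
  ⟨aestronglyMeasurable_zero, fun _ => integrable_zero _ _ _, fun A _ => ⟨0, fun ℓ => by simp⟩⟩

lemma MemL1.sum {ι : Type*} (s : Finset ι) {F : ι → Ω → ℝ} (h : ∀ i ∈ s, MemL1 m (F i)) :
    MemL1 m (fun x => ∑ i ∈ s, F i x) := by
  classical
  induction s using Finset.induction_on with
  | empty => exact MemL1.zero
  | insert a s ha ih =>
    simp only [Finset.sum_insert ha]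
    exact (h a (Finset.mem_insert_self _ _)).add
      (ih fun i hi => h i (Finset.mem_insert_of_mem hi))

lemma MemL1.const (c : ℝ) : MemL1 m (fun _ : Ω => c) := by
  refine ⟨aestronglyMeasurable_const, fun ℓ => integrable_const c, fun A hA =>
    ⟨c • m A, fun ℓ => ?_⟩⟩
  rw [VectorMeasure.integral_const]
  simp [VectorMeasure.restrict_apply _ hA, mul_comm]

lemma MemL1.indicator (hf : MemL1 m f) {B : Set Ω} (hB : MeasurableSet B) :
    MemL1 m (B.indicator f) := by
  refine ⟨hf.1.indicator hB, fun ℓ => (hf.2.1 ℓ).indicator hB, fun A hA => ?_⟩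
  obtain ⟨e, he⟩ := hf.2.2 (A ∩ B) (hA.inter hB)
  exact ⟨e, fun ℓ => by rw [he, VectorMeasure.setIntegral_indicator hA hB]⟩

lemma norm_le_of_dual {x : E} {C : ℝ}
    (h : ∀ ℓ : StrongDual ℝ E, ‖ℓ‖ ≤ 1 → ‖ℓ x‖ ≤ C) : ‖x‖ ≤ C := by
  obtain ⟨ℓ, h1, h2⟩ := exists_dual_vector'' ℝ x
  have := h ℓ h1
  rw [h2] at this
  simpa using this

lemma integrable_of_eNormLp_lt_top (hf : AEStronglyMeasurable f m.variation)
    (h : eNormLp m 1 f < ∞) (ℓ : StrongDual ℝ E) : Integrable f (scal m ℓ).variation := by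
  have hball : ∀ ℓ : StrongDual ℝ E, ‖ℓ‖ ≤ 1 → Integrable f (scal m ℓ).variation := fun ℓ hℓ => by
    rw [← memLp_one_iff_integrable]
    refine ⟨hf.mono_ac (scal_ac m ℓ), ?_⟩
    have := (eLpNorm_le_eNormLp (m := m) (p := 1) (f := f) hℓ).trans_lt h
    simpa using this
  by_cases h0 : ‖ℓ‖ = 0
  · exact hball ℓ (by rw [h0]; exact zero_le_one)
  have h1 : ℓ = ‖ℓ‖ • (‖ℓ‖⁻¹ • ℓ) := by rw [smul_smul, mul_inv_cancel₀ h0, one_smul]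
  rw [h1, scal_smul, VectorMeasure.variation_smul]
  refine (hball _ ?_).smul_measure_nnreal
  rw [norm_smul, norm_inv, norm_norm, inv_mul_cancel₀ h0]

/-- `L¹(m)` is closed for the norm, if `E` is complete. -/
lemma MemL1.of_tendsto [CompleteSpace E] {F : ℕ → Ω → ℝ} (hF : ∀ n, MemL1 m (F n))
    (hf : AEStronglyMeasurable f m.variation)
    (h : Tendsto (fun n => eNormLp m 1 (F n - f)) atTop (𝓝 0)) : MemL1 m f := by
  have hint : ∀ ℓ : StrongDual ℝ E, Integrable f (scal m ℓ).variation := by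
    obtain ⟨n, hn⟩ := (h.eventually (gt_mem_nhds ENNReal.zero_lt_top)).exists
    intro ℓ
    have h1 := integrable_of_eNormLp_lt_top ((hF n).1.sub hf) hn ℓ
    have h2 := ((hF n).2.1 ℓ).sub h1
    simpa using h2
  refine ⟨hf, hint, fun A hA => ?_⟩
  choose e he using fun n => (hF n).2.2 A hA
  have hR : Tendsto (fun n => (eNormLp m 1 (F n - f)).toReal) atTop (𝓝 0) := by
    exact (ENNReal.tendsto_toReal ENNReal.zero_ne_top).comp h
  have key : ∀ n, eNormLp m 1 (F n - f) < ∞ → ∀ ℓ : StrongDual ℝ E, ‖ℓ‖ ≤ 1 →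
      ‖ℓ (e n) - ∫ᵛ x in A, f x ∂<•(scal m ℓ)‖ ≤ (eNormLp m 1 (F n - f)).toReal := by
    intro n hn ℓ hℓ
    rw [he n ℓ, ← VectorMeasure.integral_fun_sub
      (VectorMeasure.Integrable.integrableOn ((hF n).2.1 ℓ))
      (VectorMeasure.Integrable.integrableOn (hint ℓ))]
    refine (norm_setIntegral_le _ (((hF n).2.1 ℓ).sub (hint ℓ))).trans ?_
    rw [← ENNReal.ofReal_le_iff_le_toReal hn.ne]
    refine le_trans (le_of_eq ?_) (eLpNorm_le_eNormLp hℓ)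
    rw [eLpNorm_one_eq (((hF n).2.1 ℓ).sub (hint ℓ))]
  have hfin : ∀ᶠ n in atTop, eNormLp m 1 (F n - f) < ∞ :=
    h.eventually (gt_mem_nhds ENNReal.zero_lt_top)
  have hcau : CauchySeq e := by
    rw [Metric.cauchySeq_iff]
    intro ε hε
    have h1 : ∀ᶠ n in atTop, (eNormLp m 1 (F n - f)).toReal < ε / 3 :=
      hR.eventually (gt_mem_nhds (by positivity))
    obtain ⟨N, hN⟩ := (h1.and hfin).exists_forall_of_atTop
    refine ⟨N, fun a ha b hb => ?_⟩
    rw [dist_eq_norm]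
    refine lt_of_le_of_lt (norm_le_of_dual (C := ε / 3 + ε / 3)
      fun ℓ hℓ => ?_) (by linarith)
    have k1 := (key a (hN a ha).2 ℓ hℓ).trans (hN a ha).1.le
    have k2 := (key b (hN b hb).2 ℓ hℓ).trans (hN b hb).1.le
    rw [map_sub]
    calc ‖ℓ (e a) - ℓ (e b)‖ = ‖(ℓ (e a) - ∫ᵛ x in A, f x ∂<•(scal m ℓ))
          - (ℓ (e b) - ∫ᵛ x in A, f x ∂<•(scal m ℓ))‖ := by congr 1; ring
      _ ≤ _ := (norm_sub_le _ _).trans (add_le_add k1 k2)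
  obtain ⟨e', he'⟩ := cauchySeq_tendsto_of_complete hcau
  have hball : ∀ ℓ : StrongDual ℝ E, ‖ℓ‖ ≤ 1 → ℓ e' = ∫ᵛ x in A, f x ∂<•(scal m ℓ) := by
    intro ℓ hℓ
    refine tendsto_nhds_unique ((ℓ.continuous.tendsto e').comp he') ?_
    rw [tendsto_iff_norm_sub_tendsto_zero]
    refine squeeze_zero' (Eventually.of_forall fun _ => norm_nonneg _) ?_ hR
    filter_upwards [hfin] with n hn using key n hn ℓ hℓ
  refine ⟨e', fun ℓ => ?_⟩
  by_cases h0 : ‖ℓ‖ = 0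
  · exact hball ℓ (by rw [h0]; exact zero_le_one)
  have h1 : ℓ = ‖ℓ‖ • (‖ℓ‖⁻¹ • ℓ) := by rw [smul_smul, mul_inv_cancel₀ h0, one_smul]
  have h2 := hball (‖ℓ‖⁻¹ • ℓ) (by rw [norm_smul, norm_inv, norm_norm, inv_mul_cancel₀ h0])
  rw [scal_smul, VectorMeasure.restrict_smul, VectorMeasure.integral_smul_vectorMeasure,
    smul_apply, smul_eq_mul, smul_eq_mul] at h2
  exact mul_left_cancel₀ (inv_ne_zero h0) h2

/-- `L¹(m)` is an ideal in the measurable functions, if `E` is complete. -/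
lemma MemL1.mono [CompleteSpace E] (hg : MemL1 m g) (hf : AEStronglyMeasurable f m.variation)
    (h : ∀ᵐ x ∂m.variation, |f x| ≤ |g x|) : MemL1 m f := by
  classical
  set f' := hf.mk f
  set g' := hg.1.mk g
  have hff' : f =ᵐ[m.variation] f' := hf.ae_eq_mk
  have hgg' : g =ᵐ[m.variation] g' := hg.1.ae_eq_mk
  have hf'm : Measurable f' := hf.stronglyMeasurable_mk.measurable
  have hg'm : Measurable g' := hg.1.stronglyMeasurable_mk.measurable
  have hg' : MemL1 m g' := hg.congr hgg'
  have h' : ∀ᵐ x ∂m.variation, |f' x| ≤ |g' x| := by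
    filter_upwards [h, hff', hgg'] with x h1 h2 h3
    rwa [← h2, ← h3]
  refine MemL1.congr ?_ hff'.symm
  set q : Ω → ℝ := fun x => f' x / g' x
  have hqm : Measurable q := hf'm.div hg'm
  let F : ℕ → Ω → ℝ := fun n x => ∑ k ∈ Finset.Icc (-(n + 1 : ℤ)) (n + 1),
    ((k : ℝ) / (n + 1)) * ({x | ⌊(n + 1) * q x⌋ = k}.indicator g' x)
  have hFmem : ∀ n, MemL1 m (F n) := fun n => by
    refine MemL1.sum _ fun k _ => ?_
    refine (hg'.indicator ?_).smul ((k : ℝ) / (n + 1))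
    exact (Int.measurable_floor.comp (hqm.const_mul _)) (measurableSet_singleton k)
  have hFeq : ∀ n, ∀ x, |f' x| ≤ |g' x| →
      |F n x - f' x| ≤ |((1 : ℝ) / (n + 1)) * g' x| := by
    intro n x hx
    have hn : (0 : ℝ) < n + 1 := by positivity
    by_cases hg0 : g' x = 0
    · have hf0 : f' x = 0 := by
        rw [hg0, abs_zero] at hx
        exact abs_nonpos_iff.1 hx
      have : F n x = 0 := Finset.sum_eq_zero fun k _ => by
        simp [Set.indicator, hg0]
      rw [this, hf0, hg0]; simp
    · have hq1 : |q x| ≤ 1 := by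
        simp only [q, abs_div]
        exact div_le_one_of_le₀ hx (abs_nonneg _)
      have hq2 := abs_le.1 hq1
      have hmem : ⌊((n : ℝ) + 1) * q x⌋ ∈ Finset.Icc (-(n + 1 : ℤ)) (n + 1) := by
        rw [Finset.mem_Icc]
        constructor
        · rw [Int.le_floor]; push_cast; nlinarith
        · have : (⌊((n : ℝ) + 1) * q x⌋ : ℝ) ≤ ((n + 1 : ℤ) : ℝ) :=
            (Int.floor_le _).trans (by push_cast; nlinarith)
          exact_mod_cast this
      have hFx : F n x = ((⌊((n : ℝ) + 1) * q x⌋ : ℝ) / (n + 1)) * g' x := by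
        have : F n x = ∑ k ∈ Finset.Icc (-(n + 1 : ℤ)) (n + 1),
            if ⌊((n : ℝ) + 1) * q x⌋ = k then ((k : ℝ) / (n + 1)) * g' x else 0 := by
          refine Finset.sum_congr rfl fun k _ => ?_
          simp only [Set.indicator, Set.mem_ofPred_eq]
          split_ifs <;> simp
        rw [this, Finset.sum_ite_eq, if_pos hmem]
      have hfx : f' x = q x * g' x := by simp only [q]; field_simp
      rw [hFx, hfx, ← sub_mul, abs_mul, abs_mul]
      refine mul_le_mul_of_nonneg_right ?_ (abs_nonneg _)
      have e1 : (⌊((n : ℝ) + 1) * q x⌋ : ℝ) / (n + 1) - q x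
          = ((⌊((n : ℝ) + 1) * q x⌋ : ℝ) - (n + 1) * q x) / (n + 1) := by field_simp
      rw [e1, abs_div, abs_div, abs_of_pos hn, abs_one]
      refine div_le_div_of_nonneg_right ?_ hn.le
      rw [abs_le]
      constructor
      · linarith [Int.sub_one_lt_floor (((n : ℝ) + 1) * q x)]
      · linarith [Int.floor_le (((n : ℝ) + 1) * q x)]
  refine MemL1.of_tendsto hFmem hf'm.aestronglyMeasurable ?_
  have hbd : ∀ n, eNormLp m 1 (F n - f') ≤ ‖(1 : ℝ) / (n + 1)‖ₑ * eNormLp m 1 g' := fun n => by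
    rw [← eNormLp_smul]
    refine eNormLp_mono ?_
    filter_upwards [h'] with x hx using hFeq n x hx
  refine tendsto_of_tendsto_of_tendsto_of_le_of_le tendsto_const_nhds ?_ (fun _ => zero_le) hbd
  have h1 : Tendsto (fun n : ℕ => ‖(1 : ℝ) / (n + 1)‖ₑ) atTop (𝓝 0) := by
    rw [← tendsto_zero_iff_enorm_tendsto_zero]
    exact tendsto_one_div_add_atTop_nhds_zero_nat
  simpa using ENNReal.Tendsto.mul_const h1 (Or.inr hg'.eNormLp_lt_top.ne)

lemma rpow_sub_le (hp : 1 ≤ p) {ε : ℝ} (hε : 0 < ε) : ∃ C : ℝ≥0, ∀ a b : ℝ, 0 ≤ a → 0 ≤ b →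
    |a ^ (p : ℝ) - b ^ (p : ℝ)| ≤ ε * (a ^ (p : ℝ) + b ^ (p : ℝ)) + C * |a - b| ^ (p : ℝ) := by
  have hp' : (1 : ℝ) ≤ p := by exact_mod_cast hp
  have hp0 : (0 : ℝ) < p := by linarith
  have hlim : Tendsto (fun t : ℝ => (1 - t) * (1 / (1 - t)) ^ (p : ℝ)) (𝓝[>] 0) (𝓝 1) := by
    have : ContinuousAt (fun t : ℝ => (1 - t) * (1 / (1 - t)) ^ (p : ℝ)) 0 := by
      refine ContinuousAt.mul (by fun_prop) (ContinuousAt.rpow_const ?_ (Or.inr hp0.le))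
      exact ContinuousAt.div (by fun_prop) (by fun_prop) (by norm_num)
    have h2 := this.tendsto
    simp only [sub_zero, one_div_one, Real.one_rpow, mul_one] at h2
    exact h2.mono_left nhdsWithin_le_nhds
  have hlt : Set.Ioo (0 : ℝ) 1 ∈ 𝓝[>] (0 : ℝ) := Ioo_mem_nhdsGT one_pos
  obtain ⟨t, ht1, ht0, ht2⟩ := ((hlim.eventually (gt_mem_nhds (show (1 : ℝ) < 1 + ε by linarith))).and
    hlt).exists
  have key : ∀ a b : ℝ, 0 ≤ b → b ≤ a →
      a ^ (p : ℝ) - b ^ (p : ℝ) ≤ ε * b ^ (p : ℝ) + (t * (1 / t) ^ (p : ℝ)) * (a - b) ^ (p : ℝ) := by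
    intro a b hb hab
    have h1t : 0 < 1 - t := by linarith
    have hc := (convexOn_rpow hp').2 (x := b * (1 / (1 - t))) (y := (a - b) * (1 / t))
      (by simp only [Set.mem_Ici]; positivity)
      (by simp only [Set.mem_Ici]; exact mul_nonneg (by linarith) (by positivity))
      h1t.le ht0.le (by ring)
    simp only [smul_eq_mul] at hc
    rw [Real.mul_rpow hb (by positivity), Real.mul_rpow (by linarith) (by positivity)] at hc
    have e : (1 - t) * (b * (1 / (1 - t))) + t * ((a - b) * (1 / t)) = a := by field_simp; ring
    rw [e] at hc
    have hbp : 0 ≤ b ^ (p : ℝ) := Real.rpow_nonneg hb _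
    nlinarith [mul_le_mul_of_nonneg_right ht1.le hbp]
  refine ⟨NNReal.mk (t * (1 / t) ^ (p : ℝ)) (by positivity), fun a b ha hb => ?_⟩
  rw [NNReal.coe_mk]
  have hap : 0 ≤ a ^ (p : ℝ) := Real.rpow_nonneg ha _
  have hbp : 0 ≤ b ^ (p : ℝ) := Real.rpow_nonneg hb _
  have := mul_nonneg hε.le hap
  have := mul_nonneg hε.le hbp
  rcases le_total b a with h | h
  · rw [abs_of_nonneg (sub_nonneg.2 h),
      abs_of_nonneg (sub_nonneg.2 (Real.rpow_le_rpow hb h hp0.le))]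
    linarith [key a b hb h]
  · rw [abs_sub_comm, abs_sub_comm a b, abs_of_nonneg (sub_nonneg.2 h),
      abs_of_nonneg (sub_nonneg.2 (Real.rpow_le_rpow ha h hp0.le))]
    linarith [key b a ha h]

lemma aesm_rpow {μ : Measure Ω} (hf : AEStronglyMeasurable f μ) (r : ℝ) (hr : 0 ≤ r) :
    AEStronglyMeasurable (fun x => |f x| ^ r) μ :=
  (Real.continuous_rpow_const hr).comp_aestronglyMeasurable hf.norm

lemma MemLp.congr (hf : MemLp m p f) (h : f =ᵐ[m.variation] g) : MemLp m p g := by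
  refine ⟨hf.1.congr h, hf.2.congr ?_⟩
  filter_upwards [h] with x hx
  rw [hx]

lemma MemLp.eNormLp_lt_top (hp : 1 ≤ p) (hf : MemLp m p f) : eNormLp m p f < ∞ := by
  have h := hf.2.eNormLp_lt_top
  have hp0 : 0 < p := lt_of_lt_of_le zero_lt_one hp
  rw [eNormLp_rpow hp0] at h
  by_contra hc
  rw [not_lt, top_le_iff] at hc
  rw [hc, ENNReal.top_rpow_of_pos (by exact_mod_cast hp0)] at h
  exact lt_irrefl _ h

lemma MemLp.mono [CompleteSpace E] (hg : MemLp m p g) (hf : AEStronglyMeasurable f m.variation)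
    (h : ∀ᵐ x ∂m.variation, |f x| ≤ |g x|) : MemLp m p f := by
  refine ⟨hf, hg.2.mono (aesm_rpow hf _ p.coe_nonneg) ?_⟩
  filter_upwards [h] with x hx
  rw [abs_of_nonneg (Real.rpow_nonneg (abs_nonneg (f x)) _),
    abs_of_nonneg (Real.rpow_nonneg (abs_nonneg (g x)) _)]
  exact Real.rpow_le_rpow (abs_nonneg _) hx p.coe_nonneg

lemma MemLp.add [CompleteSpace E] (hf : MemLp m p f) (hg : MemLp m p g) :
    MemLp m p (f + g) := by
  refine ⟨hf.1.add hg.1, ((hf.2.add hg.2).smul ((2 : ℝ) ^ (p : ℝ))).mono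
    (aesm_rpow (hf.1.add hg.1) _ p.coe_nonneg) (Eventually.of_forall fun x => ?_)⟩
  rw [abs_of_nonneg (by positivity)]
  refine le_trans ?_ (le_abs_self _)
  simp only [Pi.smul_apply, Pi.add_apply, smul_eq_mul]
  have h0 : |f x + g x| ≤ 2 * max |f x| |g x| := by
    refine (abs_add_le _ _).trans ?_
    linarith [le_max_left |f x| |g x|, le_max_right |f x| |g x|]
  refine (Real.rpow_le_rpow (abs_nonneg _) h0 p.coe_nonneg).trans ?_
  rw [Real.mul_rpow (by norm_num) (le_max_of_le_left (abs_nonneg _))]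
  refine mul_le_mul_of_nonneg_left ?_ (by positivity)
  have h1 : 0 ≤ |f x| ^ (p : ℝ) := by positivity
  have h2 : 0 ≤ |g x| ^ (p : ℝ) := by positivity
  rcases max_choice |f x| |g x| with h | h <;> rw [h] <;> linarith

lemma MemLp.smul (c : ℝ) (hf : MemLp m p f) : MemLp m p (c • f) := by
  refine ⟨hf.1.const_smul c, ?_⟩
  have : (fun x => |(c • f) x| ^ (p : ℝ)) = (|c| ^ (p : ℝ)) • fun x => |f x| ^ (p : ℝ) := by
    funext x
    simp only [Pi.smul_apply, smul_eq_mul, abs_mul]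
    exact Real.mul_rpow (abs_nonneg _) (abs_nonneg _)
  rw [this]
  exact hf.2.smul _

lemma MemLp.zero (hp : 1 ≤ p) : MemLp m p (0 : Ω → ℝ) := by
  refine ⟨aestronglyMeasurable_zero, ?_⟩
  have hp0 : (p : ℝ) ≠ 0 := by
    have : (1 : ℝ) ≤ p := by exact_mod_cast hp
    linarith
  have : (fun x => |(0 : Ω → ℝ) x| ^ (p : ℝ)) = 0 := by
    funext x
    simp [Real.zero_rpow hp0]
  rw [this]
  exact MemL1.zero

/-- `L^p(m) ⊆ L¹(m)`. -/
lemma MemLp.memL1 [CompleteSpace E] (hp : 1 ≤ p) (hf : MemLp m p f) : MemL1 m f := by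
  refine ((MemL1.const 1).add hf.2).mono hf.1 (Eventually.of_forall fun x => ?_)
  simp only [Pi.add_apply]
  refine le_trans ?_ (le_abs_self _)
  have hp' : (1 : ℝ) ≤ p := by exact_mod_cast hp
  rcases le_total |f x| 1 with h | h
  · have : 0 ≤ |f x| ^ (p : ℝ) := by positivity
    linarith
  · have := Real.rpow_le_rpow_of_exponent_le h hp'
    rw [Real.rpow_one] at this
    linarith

/-- `L^p(m)` is closed for the norm, if `E` is complete. -/
lemma MemLp.of_tendsto [CompleteSpace E] (hp : 1 ≤ p) {F : ℕ → Ω → ℝ} (hF : ∀ n, MemLp m p (F n))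
    (hf : AEStronglyMeasurable f m.variation)
    (h : Tendsto (fun n => eNormLp m p (F n - f)) atTop (𝓝 0)) : MemLp m p f := by
  have hp0 : 0 < p := lt_of_lt_of_le zero_lt_one hp
  have hp0' : (0 : ℝ) < p := by exact_mod_cast hp0
  have hpE : 1 ≤ (p : ℝ≥0∞) := by exact_mod_cast hp
  refine ⟨hf, MemL1.of_tendsto (fun n => (hF n).2) (aesm_rpow hf _ p.coe_nonneg) ?_⟩
  have hffin : eNormLp m p f < ∞ := by
    obtain ⟨n, hn⟩ := (h.eventually (gt_mem_nhds ENNReal.zero_lt_top)).exists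
    have h1 : f = F n + (-1 : ℝ) • (F n - f) := by funext x; simp
    rw [h1]
    refine (eNormLp_add_le hpE (hF n).1 (((hF n).1.sub hf).const_smul (-1 : ℝ))).trans_lt ?_
    rw [eNormLp_smul]
    refine ENNReal.add_lt_top.2 ⟨(hF n).eNormLp_lt_top hp, ENNReal.mul_lt_top ?_ hn⟩
    simp
  set M : ℝ≥0∞ := (eNormLp m p f + 1) ^ (p : ℝ) + eNormLp m p f ^ (p : ℝ) with hM
  have hMfin : M ≠ ∞ := by
    refine (ENNReal.add_lt_top.2 ⟨?_, ?_⟩).ne <;> apply ENNReal.rpow_lt_top_of_nonneg p.coe_nonneg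
    · exact (ENNReal.add_lt_top.2 ⟨hffin, ENNReal.one_lt_top⟩).ne
    · exact hffin.ne
  have hbound : ∀ ε : ℝ, 0 < ε → ∃ C : ℝ≥0, ∀ᶠ n in atTop,
      eNormLp m 1 ((fun x => |F n x| ^ (p : ℝ)) - fun x => |f x| ^ (p : ℝ))
        ≤ ENNReal.ofReal ε * M + C * eNormLp m p (F n - f) ^ (p : ℝ) := by
    intro ε hε
    obtain ⟨C, hC⟩ := rpow_sub_le hp hε
    refine ⟨C, ?_⟩
    filter_upwards [h.eventually (gt_mem_nhds zero_lt_one)] with n hn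
    have hFn : eNormLp m p (F n) ≤ eNormLp m p f + 1 := by
      have h1 : F n = f + (F n - f) := by funext x; simp
      rw [h1]
      exact (eNormLp_add_le hpE hf ((hF n).1.sub hf)).trans
        (add_le_add le_rfl (by simpa using hn.le))
    have hm1 := aesm_rpow (hF n).1 p hp0'.le
    have hm2 := aesm_rpow hf p hp0'.le
    have hm3 := aesm_rpow ((hF n).1.sub hf) p hp0'.le
    calc _ ≤ eNormLp m 1 (ε • ((fun x => |F n x| ^ (p : ℝ)) + fun x => |f x| ^ (p : ℝ))
          + (C : ℝ) • fun x => |(F n - f) x| ^ (p : ℝ)) := by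
          refine eNormLp_mono (Eventually.of_forall fun x => ?_)
          refine le_trans ?_ (le_abs_self _)
          simp only [Pi.sub_apply, Pi.add_apply, Pi.smul_apply, smul_eq_mul]
          refine (hC _ _ (abs_nonneg _) (abs_nonneg _)).trans ?_
          have := Real.rpow_le_rpow (abs_nonneg _) (abs_abs_sub_abs_le (F n x) (f x)) hp0'.le
          gcongr
      _ ≤ ENNReal.ofReal ε * (eNormLp m p (F n) ^ (p : ℝ) + eNormLp m p f ^ (p : ℝ))
          + C * eNormLp m p (F n - f) ^ (p : ℝ) := by
          refine (eNormLp_add_le (by simp) ((hm1.add hm2).const_smul ε)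
            (hm3.const_smul (C : ℝ))).trans ?_
          rw [eNormLp_smul, eNormLp_smul, ← eNormLp_rpow hp0, ← eNormLp_rpow hp0,
            ← eNormLp_rpow hp0, Real.enorm_of_nonneg hε.le, Real.enorm_of_nonneg C.coe_nonneg,
            ENNReal.ofReal_coe_nnreal]
          gcongr
          exact eNormLp_add_le (by simp) hm1 hm2
      _ ≤ _ := by
          rw [hM]
          gcongr
  rw [ENNReal.tendsto_nhds_zero]
  intro η hη
  have hη2 : (0 : ℝ≥0∞) < η / 2 := ENNReal.half_pos hη.ne'
  obtain ⟨ε, hε, hεM⟩ : ∃ ε : ℝ, 0 < ε ∧ ENNReal.ofReal ε * M ≤ η / 2 := by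
    obtain ⟨n, hn0, hn⟩ := ENNReal.exists_nnreal_pos_mul_lt hMfin hη2.ne'
    refine ⟨n, by exact_mod_cast hn0, ?_⟩
    rw [ENNReal.ofReal_coe_nnreal]
    exact hn.le
  obtain ⟨C, hC⟩ := hbound ε hε
  have hlim : Tendsto (fun n => (C : ℝ≥0∞) * eNormLp m p (F n - f) ^ (p : ℝ)) atTop (𝓝 0) := by
    have h1 : Tendsto (fun n => eNormLp m p (F n - f) ^ (p : ℝ)) atTop (𝓝 0) := by
      have := (ENNReal.continuous_rpow_const (y := (p : ℝ))).tendsto 0 |>.comp h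
      rwa [ENNReal.zero_rpow_of_pos hp0'] at this
    simpa using ENNReal.Tendsto.const_mul h1 (Or.inr ENNReal.coe_ne_top)
  filter_upwards [hC, ENNReal.tendsto_nhds_zero.1 hlim _ hη2] with n h1 h2
  calc _ ≤ _ := h1
    _ ≤ η / 2 + η / 2 := add_le_add hεM h2
    _ = η := ENNReal.add_halves η

/-- The integral `∫ f dm ∈ E`: the element with `ℓ (∫ f dm) = ∫ f d⟨m, ℓ⟩` for all `ℓ` (and `0` if
there is none). -/
def integral (m : VectorMeasure Ω E) (f : Ω → ℝ) : E :=
  open Classical in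
  if h : ∃ e : E, ∀ ℓ : StrongDual ℝ E, ℓ e = ∫ᵛ x, f x ∂<•(scal m ℓ) then h.choose else 0

lemma integral_spec (hf : MemL1 m f) (ℓ : StrongDual ℝ E) :
    ℓ (integral m f) = ∫ᵛ x, f x ∂<•(scal m ℓ) := by
  have h : ∃ e : E, ∀ ℓ : StrongDual ℝ E, ℓ e = ∫ᵛ x, f x ∂<•(scal m ℓ) := by
    simpa using hf.2.2 Set.univ MeasurableSet.univ
  rw [integral, dif_pos h]
  exact h.choose_spec ℓ

end General

section Space

variable {Ω : Type*} [MeasurableSpace Ω] {E : Type*} [NormedAddCommGroup E] [NormedSpace ℝ E]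
  [CompleteSpace E] {m : VectorMeasure Ω E} {p : ℝ≥0}

lemma one_le_of_fact [hp : Fact (1 ≤ (p : ℝ≥0∞))] : 1 ≤ p := by exact_mod_cast hp.out

/-- The space `L^p(m)` of classes, modulo equality off an `m`-null set, of functions `f` such that
`|f|^p` is `m`-integrable. -/
def LpSpace (m : VectorMeasure Ω E) (p : ℝ≥0) [Fact (1 ≤ (p : ℝ≥0∞))] :
    Submodule ℝ (Ω →ₘ[m.variation] ℝ) where
  carrier := {f | MemLp m p f}
  add_mem' {f g} hf hg := (MemLp.add hf hg).congr (AEEqFun.coeFn_add f g).symm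
  zero_mem' := (MemLp.zero one_le_of_fact).congr AEEqFun.coeFn_zero.symm
  smul_mem' c f hf := (MemLp.smul c hf).congr (AEEqFun.coeFn_smul c f).symm

namespace LpSpace

variable [hp : Fact (1 ≤ (p : ℝ≥0∞))]

instance : CoeFun (LpSpace m p) (fun _ => Ω → ℝ) := ⟨fun f => ((f : Ω →ₘ[m.variation] ℝ) : Ω → ℝ)⟩

/-- `‖f‖ = sup_{‖ℓ‖ ≤ 1} (∫ |f|^p d|⟨m, ℓ⟩|)^{1/p}`. -/
instance : Norm (LpSpace m p) := ⟨fun f => (eNormLp m p f).toReal⟩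

lemma norm_def (f : LpSpace m p) : ‖f‖ = (eNormLp m p f).toReal := rfl

lemma memLp (f : LpSpace m p) : MemLp m p f := f.2

lemma aesm (f : LpSpace m p) : AEStronglyMeasurable f m.variation := f.2.1

lemma eNormLp_lt_top (f : LpSpace m p) : eNormLp m p f < ∞ := (memLp f).eNormLp_lt_top one_le_of_fact

lemma coeFn_add (f g : LpSpace m p) : ⇑(f + g) =ᵐ[m.variation] ⇑f + ⇑g :=
  AEEqFun.coeFn_add f.1 g.1

lemma coeFn_sub (f g : LpSpace m p) : ⇑(f - g) =ᵐ[m.variation] ⇑f - ⇑g :=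
  AEEqFun.coeFn_sub f.1 g.1

lemma coeFn_smul (c : ℝ) (f : LpSpace m p) : ⇑(c • f) =ᵐ[m.variation] c • ⇑f :=
  AEEqFun.coeFn_smul c f.1

lemma core : NormedSpace.Core ℝ (LpSpace m p) where
  norm_nonneg _ := ENNReal.toReal_nonneg
  norm_smul c f := by
    rw [norm_def, norm_def, eNormLp_congr (coeFn_smul c f), eNormLp_smul, ENNReal.toReal_mul,
      toReal_enorm]
  norm_triangle f g := by
    rw [norm_def, norm_def, norm_def, eNormLp_congr (coeFn_add f g),
      ← ENNReal.toReal_add (eNormLp_lt_top f).ne (eNormLp_lt_top g).ne]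
    exact ENNReal.toReal_mono (ENNReal.add_lt_top.2 ⟨(eNormLp_lt_top f), (eNormLp_lt_top g)⟩).ne
      (eNormLp_add_le hp.out (aesm f) (aesm g))
  norm_eq_zero_iff f := by
    constructor
    · intro h
      rw [norm_def, ENNReal.toReal_eq_zero_iff, or_iff_left (eNormLp_lt_top f).ne] at h
      have h0 : p ≠ 0 := (lt_of_lt_of_le zero_lt_one (one_le_of_fact (p := p))).ne'
      refine Subtype.ext (AEEqFun.ext ?_)
      exact (ae_eq_zero_of_eNormLp h0 (aesm f) h).trans AEEqFun.coeFn_zero.symm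
    · rintro rfl
      have h1 : ⇑(0 : LpSpace m p) =ᵐ[m.variation] (0 : ℝ) • (0 : Ω → ℝ) := by
        rw [zero_smul]; exact AEEqFun.coeFn_zero
      rw [norm_def, eNormLp_congr h1, eNormLp_smul]
      simp

instance : NormedAddCommGroup (LpSpace m p) := NormedAddCommGroup.ofCore core

instance : NormedSpace ℝ (LpSpace m p) := NormedSpace.ofCore core

/-- The class of a `p`-integrable function. -/
def mk (f : Ω → ℝ) (hf : MemLp m p f) : LpSpace m p :=
  ⟨AEEqFun.mk f hf.1, hf.congr (AEEqFun.coeFn_mk f hf.1).symm⟩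

lemma coeFn_mk {f : Ω → ℝ} (hf : MemLp m p f) : ⇑(mk f hf) =ᵐ[m.variation] f :=
  AEEqFun.coeFn_mk f hf.1

lemma edist_eq (f g : LpSpace m p) : eNormLp m p (⇑f - ⇑g) = ENNReal.ofReal (dist f g) := by
  rw [dist_eq_norm, norm_def, ENNReal.ofReal_toReal (eNormLp_lt_top (f - g)).ne,
    eNormLp_congr (coeFn_sub f g)]

instance : CompleteSpace (LpSpace m p) := by
  refine Metric.complete_of_convergent_controlled_sequences (fun n => (1 / 2) ^ n)
    (fun n => by positivity) fun u hu => ?_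
  let B : ℕ → ℝ≥0∞ := fun n => ENNReal.ofReal ((1 / 2) ^ n)
  have hB : ∑' n, B n ≠ ∞ := by
    rw [← ENNReal.ofReal_tsum_of_nonneg (fun n => by positivity) summable_geometric_two]
    exact ENNReal.ofReal_ne_top
  have hcau : ∀ N n k, N ≤ n → N ≤ k → eNormLp m p (⇑(u n) - ⇑(u k)) < B N := by
    intro N n k hn hk
    rw [edist_eq]
    exact (ENNReal.ofReal_lt_ofReal_iff (by positivity)).2 (hu N n k hn hk)
  have hae : ∀ᵐ x ∂m.variation, ∃ l, Tendsto (fun n => (u n) x) atTop (𝓝 l) := by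
    have hmeas : MeasurableSet {x | ∃ l, Tendsto (fun n => (u n) x) atTop (𝓝 l)} :=
      measurableSet_exists_tendsto fun n => (AEEqFun.stronglyMeasurable _).measurable
    refine variation_null hmeas.compl fun ℓ hℓ => ?_
    exact Lp.ae_tendsto_of_cauchy_eLpNorm (p := p) (fun n => (aesm (u n)).mono_ac (scal_ac m ℓ)) hp.out
      hB fun N n k hn hk => (eLpNorm_le_eNormLp hℓ).trans_lt (hcau N n k hn hk)
  obtain ⟨f, hfm, hf⟩ := exists_stronglyMeasurable_limit_of_tendsto_ae (fun n => (aesm (u n))) hae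
  have hle : ∀ n, eNormLp m p (⇑(u n) - f) ≤ B n := by
    intro n
    refine eNormLp_le fun ℓ hℓ => ?_
    have hf' : ∀ᵐ x ∂(scal m ℓ).variation, Tendsto (fun k => (⇑(u n) - ⇑(u k)) x) atTop
        (𝓝 ((⇑(u n) - f) x)) := by
      filter_upwards [hf.filter_mono (scal_ac m ℓ).ae_le] with x hx using tendsto_const_nhds.sub hx
    refine (Lp.eLpNorm_lim_le_liminf_eLpNorm (fun k =>
      ((aesm (u n)).sub (aesm (u k))).mono_ac (scal_ac m ℓ)) _ hf').trans ?_
    refine liminf_le_of_le (by isBoundedDefault) fun b hb => ?_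
    obtain ⟨k, hk, hk'⟩ := (hb.and (eventually_ge_atTop n)).exists
    exact hk.trans ((eLpNorm_le_eNormLp hℓ).trans (hcau n n k le_rfl hk').le)
  have hBlim : Tendsto B atTop (𝓝 0) := by
    have h1 : Tendsto (fun n : ℕ => ((1 : ℝ) / 2) ^ n) atTop (𝓝 0) :=
      tendsto_pow_atTop_nhds_zero_of_lt_one (by norm_num) (by norm_num)
    simpa [B] using ENNReal.tendsto_ofReal h1
  have hfmem : MemLp m p f := MemLp.of_tendsto one_le_of_fact (fun n => (memLp (u n)))
    hfm.aestronglyMeasurable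
    (tendsto_of_tendsto_of_tendsto_of_le_of_le tendsto_const_nhds hBlim (fun _ => zero_le) hle)
  refine ⟨mk f hfmem, tendsto_iff_dist_tendsto_zero.2 (squeeze_zero (fun _ => dist_nonneg)
    (g := fun n : ℕ => ((1 : ℝ) / 2) ^ n) (fun n => ?_)
    (tendsto_pow_atTop_nhds_zero_of_lt_one (by norm_num) (by norm_num)))⟩
  rw [← ENNReal.ofReal_le_ofReal_iff (by positivity), ← edist_eq]
  refine (eNormLp_congr ?_).le.trans (hle n)
  filter_upwards [coeFn_mk hfmem] with x hx
  simp [hx]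

/-- The element `(∑ᵢ |fᵢ|^p)^{1/p}` of `L^p(m)`. -/
def pSum {n : ℕ} (f : Fin n → LpSpace m p) : LpSpace m p :=
  mk (fun x => (∑ i, |f i x| ^ (p : ℝ)) ^ (1 / (p : ℝ))) <| by
    have hp1 : (1 : ℝ) ≤ p := by exact_mod_cast one_le_of_fact (p := p)
    have hs : MemL1 m (fun x => ∑ i, |f i x| ^ (p : ℝ)) := MemL1.sum _ fun i _ => (memLp (f i)).2
    refine ⟨(Real.continuous_rpow_const (by positivity)).comp_aestronglyMeasurable hs.1, ?_⟩
    convert hs using 2 with x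
    have h0 : 0 ≤ ∑ i, |f i x| ^ (p : ℝ) := Finset.sum_nonneg fun i _ => by positivity
    rw [abs_of_nonneg (by positivity), ← Real.rpow_mul h0, one_div_mul_cancel (by linarith),
      Real.rpow_one]

end LpSpace

/-- The integration map `I_m : L^p(m) → E`, `f ↦ ∫ f dm`. -/
def integrationMap (m : VectorMeasure Ω E) (p : ℝ≥0) [hp : Fact (1 ≤ (p : ℝ≥0∞))] :
    LpSpace m p →ₗ[ℝ] E where
  toFun f := integral m f
  map_add' f g := by
    have hf := (LpSpace.memLp f).memL1 one_le_of_fact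
    have hg := (LpSpace.memLp g).memL1 one_le_of_fact
    have hfg := (LpSpace.memLp (f + g)).memL1 one_le_of_fact
    refine (SeparatingDual.eq_iff_forall_dual_eq (R := ℝ)).2 fun ℓ => ?_
    rw [map_add, integral_spec hf, integral_spec hg, integral_spec hfg,
      ← VectorMeasure.integral_add (hf.2.1 ℓ) (hg.2.1 ℓ)]
    exact VectorMeasure.integral_congr_ae ((scal_ac m ℓ).ae_eq (LpSpace.coeFn_add f g))
  map_smul' c f := by
    have hf := (LpSpace.memLp f).memL1 one_le_of_fact
    have hcf := (LpSpace.memLp (c • f)).memL1 one_le_of_fact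
    refine (SeparatingDual.eq_iff_forall_dual_eq (R := ℝ)).2 fun ℓ => ?_
    rw [RingHom.id_apply, map_smul, integral_spec hf, integral_spec hcf,
      ← VectorMeasure.integral_smul]
    exact VectorMeasure.integral_congr_ae ((scal_ac m ℓ).ae_eq (LpSpace.coeFn_smul c f))

/-- `T` is `p`-regular: `‖(∑ᵢ |T fᵢ|^p)^{1/p}‖ ≤ K ‖(∑ᵢ |fᵢ|^p)^{1/p}‖` for all finite families. -/
def IsPRegular {Ω' : Type*} [MeasurableSpace Ω'] {E' : Type*} [NormedAddCommGroup E']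
    [NormedSpace ℝ E'] [CompleteSpace E'] [Fact (1 ≤ (p : ℝ≥0∞))] {m' : VectorMeasure Ω' E'}
    (T : LpSpace m p →ₗ[ℝ] LpSpace m' p) : Prop :=
  ∃ K : ℝ, 0 < K ∧ ∀ (n : ℕ) (f : Fin n → LpSpace m p),
    ‖LpSpace.pSum (fun i => T (f i))‖ ≤ K * ‖LpSpace.pSum f‖

/-- `ν` is a control measure for `m`: a finite measure with `m ≪ ν`. Measures with exactly the same
null sets as `m` are included. -/
def IsControlMeasure (m : VectorMeasure Ω E) (ν : Measure Ω) : Prop :=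
  IsFiniteMeasure ν ∧ ∀ A, MeasurableSet A → ν A = 0 → m A = 0

/-- The closed unit ball of the Köthe dual `L¹(m)'` of `L¹(m)` with respect to `ν`: the classes `g`
with `f g ∈ L¹(ν)` for all `f ∈ L¹(m)`, and `∫ f g dν ≤ 1` if moreover `‖f‖_{L¹(m)} ≤ 1`. -/
def kotheDualBall (m : VectorMeasure Ω E) (ν : Measure Ω) : Set (Ω →ₘ[ν] ℝ) :=
  {g | ∀ f : Ω → ℝ, Measurable f → MemL1 m f →
    Integrable (fun x => f x * g x) ν ∧ (eNormLp m 1 f ≤ 1 → ∫ x, f x * g x ∂ν ≤ 1)}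

end Space

section Weights

variable {Ω : Type*} [MeasurableSpace Ω] {μ : Measure Ω}

/-- Relative weak compactness of a subset of a normed space. -/
def IsRelWeaklyCompact {X : Type*} [NormedAddCommGroup X] [NormedSpace ℝ X] (V : Set X) : Prop :=
  IsCompact (closure (toWeakSpace ℝ X '' V))

/-- The measure `w dμ` of a weight `w`. -/
def weighted (μ : Measure Ω) (w : Ω →₁[μ] ℝ) : Measure Ω :=
  μ.withDensity fun x => ENNReal.ofReal (w x)

/-- The functional `v ↦ ∫_A v dμ` on `L¹(μ)`. -/
def setInt (μ : Measure Ω) (A : Set Ω) : StrongDual ℝ (Ω →₁[μ] ℝ) where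
  toFun v := ∫ x in A, v x ∂μ
  map_add' v w := by
    rw [← integral_add (L1.integrable_coeFn v).integrableOn (L1.integrable_coeFn w).integrableOn]
    exact integral_congr_ae (ae_restrict_of_ae (Lp.coeFn_add v w))
  map_smul' c v := by
    rw [RingHom.id_apply, ← integral_smul]
    exact integral_congr_ae (ae_restrict_of_ae (Lp.coeFn_smul c v))
  cont := continuous_setIntegral A

lemma setInt_apply (A : Set Ω) (v : Ω →₁[μ] ℝ) : setInt μ A v = ∫ x in A, v x ∂μ := rfl

lemma continuous_weak {X : Type*} [NormedAddCommGroup X] [NormedSpace ℝ X] (φ : StrongDual ℝ X) :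
    Continuous fun x : WeakSpace ℝ X => φ ((toWeakSpace ℝ X).symm x) :=
  WeakBilin.eval_continuous (topDualPairing ℝ X).flip φ

lemma memlp_setInt {V : Set (Ω →₁[μ] ℝ)} (hV : IsRelWeaklyCompact V) (A : Set Ω) :
    Memℓp (fun v : V => setInt μ A v.1) ∞ := by
  refine memℓp_infty ?_
  refine ((hV.image (continuous_weak (setInt μ A)).norm).bddAbove).mono ?_
  rintro _ ⟨v, rfl⟩
  exact ⟨toWeakSpace ℝ _ v.1, subset_closure ⟨v.1, v.2, rfl⟩, by simp⟩

lemma setInt_nonneg {V : Set (Ω →₁[μ] ℝ)} (hpos : ∀ v ∈ V, 0 ≤ v) (A : Set Ω)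
    {x : WeakSpace ℝ (Ω →₁[μ] ℝ)} (hx : x ∈ closure (toWeakSpace ℝ _ '' V)) :
    0 ≤ setInt μ A ((toWeakSpace ℝ _).symm x) := by
  have hc : IsClosed {x : WeakSpace ℝ (Ω →₁[μ] ℝ) | 0 ≤ setInt μ A ((toWeakSpace ℝ _).symm x)} :=
    isClosed_le continuous_const (continuous_weak _)
  refine closure_minimal ?_ hc hx
  rintro _ ⟨v, hv, rfl⟩
  have h0 : 0 ≤ᵐ[μ] v := (Lp.coeFn_nonneg v).2 (hpos v hv)
  exact integral_nonneg_of_ae (ae_restrict_of_ae h0)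

open Classical in
/-- The vector measure `m_V : A ↦ (∫_A v dμ)_{v ∈ V} ∈ ℓ^∞(V)` of a relatively weakly compact set
`V` of weights in `L¹(μ)₊`. -/
def weightMeasure (μ : Measure Ω) (V : Set (Ω →₁[μ] ℝ)) (hpos : ∀ v ∈ V, 0 ≤ v)
    (hV : IsRelWeaklyCompact V) : VectorMeasure Ω (lp (fun _ : V => ℝ) ∞) where
  measureOf' A := if MeasurableSet A then ⟨fun v => ∫ x in A, v.1 x ∂μ, memlp_setInt hV A⟩ else 0
  empty' := by
    rw [if_pos MeasurableSet.empty]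
    ext v
    simp
  not_measurable' A hA := if_neg hA
  m_iUnion' A hA hd := by
    simp only [hA, if_true, MeasurableSet.iUnion hA]
    have hsum : ∀ v : Ω →₁[μ] ℝ, HasSum (fun n => setInt μ (A n) v) (setInt μ (⋃ n, A n) v) :=
      fun v => hasSum_integral_iUnion hA hd (L1.integrable_coeFn v).integrableOn
    have hunif : TendstoUniformlyOn (fun (s : Finset ℕ) (x : WeakSpace ℝ (Ω →₁[μ] ℝ)) =>
        ∑ n ∈ s, setInt μ (A n) ((toWeakSpace ℝ _).symm x))
        (fun x => setInt μ (⋃ n, A n) ((toWeakSpace ℝ _).symm x)) atTop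
        (closure (toWeakSpace ℝ _ '' V)) := by
      refine Monotone.tendstoUniformlyOn_of_forall_tendsto hV
        (fun s => (continuous_finsetSum _ fun n _ => continuous_weak _).continuousOn)
        (fun x hx s t hst => ?_) (continuous_weak _).continuousOn (fun x _ => hsum _)
      exact Finset.sum_le_sum_of_subset_of_nonneg hst fun n _ _ => setInt_nonneg hpos _ hx
    rw [HasSum, SummationFilter.unconditional_filter, Metric.tendsto_nhds]
    intro ε hε
    filter_upwards [Metric.tendstoUniformlyOn_iff.1 hunif (ε / 2) (half_pos hε)] with s hs
    rw [dist_eq_norm]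
    refine lt_of_le_of_lt (lp.norm_le_of_forall_le (half_pos hε).le fun v => ?_) (half_lt_self hε)
    have h1 := (hs (toWeakSpace ℝ _ v.1) (subset_closure ⟨v.1, v.2, rfl⟩)).le
    rw [dist_comm, Real.dist_eq] at h1
    rw [lp.coeFn_sub, Pi.sub_apply, lp.coeFn_sum, Finset.sum_apply]
    exact h1

/-- `W ⊆ L¹(ν)₊` is a conjugate family of weights for `V ⊆ L¹(μ)₊` with respect to the operator
`T : L^p(m) → L^p(n)`, regarded for each `v ∈ V` as an operator into `L^p(v dμ)`.
With one constant `C` for all `w` and `v`: for `w ∈ W` the formal identity `L^p(m) → L^p(w dν)` is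
well defined and bounded by `C`, and for each `v ∈ V` there is `w ∈ W` such that `T` induces an
operator `S : L^p(w dν) → L^p(v dμ)` bounded by `C`. -/
def IsConjugateFamily {Λ E F : Type*} [MeasurableSpace Λ] [NormedAddCommGroup E] [NormedSpace ℝ E]
    [CompleteSpace E] [NormedAddCommGroup F] [NormedSpace ℝ F] [CompleteSpace F]
    {m : VectorMeasure Λ E} {n : VectorMeasure Ω F} {p : ℝ≥0} [Fact (1 ≤ (p : ℝ≥0∞))]
    (T : LpSpace m p →ₗ[ℝ] LpSpace n p) (ν : Measure Λ) (μ : Measure Ω)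
    (V : Set (Ω →₁[μ] ℝ)) (W : Set (Λ →₁[ν] ℝ)) : Prop :=
  (∀ w ∈ W, 0 ≤ w) ∧ ∃ C : ℝ,
    (∀ w ∈ W, weighted ν w ≪ m.variation ∧ ∃ i : LpSpace m p →L[ℝ] Lp ℝ p (weighted ν w),
      (∀ f, i f =ᵐ[weighted ν w] f) ∧ ‖i‖ ≤ C) ∧
    ∀ v ∈ V, ∃ w ∈ W, ∃ S : Lp ℝ p (weighted ν w) →L[ℝ] Lp ℝ p (weighted μ v),
      (∀ (f : LpSpace m p) (g : Lp ℝ p (weighted ν w)), g =ᵐ[weighted ν w] f →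
        S g =ᵐ[weighted μ v] T f) ∧ ‖S‖ ≤ C

end Weights

end VectorLp

end

/-! The implication (i) ⇒ (ii) is a Maurey–Rosenthal factorization carried out for each weight
separately. The coordinate functional of `ℓ^∞(V)` at `v` has norm at most one and turns `m_V` into
`v dμ`, so `L^p(m_V)` embeds contractively into `L^p(v dμ)`. There the p-th powers of norms of a
p-sum add, and `p`-regularity becomes `∑ ‖I_m f_i‖^p ≤ K^p ‖∑ |f_i|^p‖_{L¹(m)}`. On simple functions
a Hahn–Banach sandwich (`exists_linearMap_le_sublinear_of_cone`) yields a linear `φ` dominated by `s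
↦ ‖s⁺‖_{L¹(m)}` with `‖I_m s‖^p ≤ K^p φ(|s|^p)`.

Such a `φ` is positive, and on indicators it is at most the semivariation of `m`. Since the
semivariation of a countably additive measure is continuous at the empty set, `φ` is integration
against a finite measure `κ` (`exists_measure_of_le_eNormLp`). This is what puts the dominating
functional in the Köthe dual: `κ ≪ m ≪ ν`, and the density of `κ` is the required weight
(`exists_weight_of_lintegral_le`). The induced operator comes from density of simple functions in
`L^p(κ)` (`exists_factorization_integrationMap`). The bounds `1` and `K` do not depend on `v`.

For (ii) ⇒ (i), every bounded operator between spaces `L^p(w dν)` and `L^p(v dμ)` respects p-sums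
with its own norm as constant (`eLpNorm_pSum_le`), so a factorization uniform in `v` bounds the
p-sum in every `L^p(v dμ)`. The supremum over `V` recovers the norm of `L^p(m_V)` up to a factor `2`
(`eNormLp_weightMeasure_le`). -/

namespace VectorLp

/-! ### Continuity of the semivariation at the empty set -/

section Semivariation

variable {Ω : Type*} [MeasurableSpace Ω] {E : Type*} [NormedAddCommGroup E]
  {m : VectorMeasure Ω E}

/-- A countably additive vector measure is uniformly small on the measurable subsets of the sets of
a sequence decreasing to the empty set. -/
lemma exists_forall_subset_norm_le {D : ℕ → Set Ω} (hD : ∀ n, MeasurableSet (D n))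
    (hanti : Antitone D) (hempty : ⋂ n, D n = ∅) {ε : ℝ} (hε : 0 < ε) :
    ∃ n, ∀ B ⊆ D n, MeasurableSet B → ‖m B‖ ≤ ε := by
  by_contra! hcon
  choose B hBD hBm hB using hcon
  have hnext : ∀ n, ∃ k, n < k ∧ ε / 2 < ‖m (B n \ D k)‖ := fun n => by
    have h1 : Tendsto (fun k => m (B n ∩ D k)) atTop (𝓝 0) := by
      have := VectorMeasure.tendsto_vectorMeasure_iInter_atTop_nat (v := m)
        (s := fun k => B n ∩ D k)
        (fun i j hij => Set.inter_subset_inter_right _ (hanti hij))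
        (fun k => (hBm n).inter (hD k))
      rwa [← Set.inter_iInter, hempty, Set.inter_empty, VectorMeasure.empty] at this
    have h2 := h1.norm.eventually (gt_mem_nhds (show ‖(0 : E)‖ < ε / 2 by simpa using hε))
    obtain ⟨k, hk, hnk⟩ := (h2.and (eventually_gt_atTop n)).exists
    refine ⟨k, hnk, ?_⟩
    have h3 := m.of_union (A := B n ∩ D k) (B := B n \ D k) Set.disjoint_sdiff_inter.symm
      ((hBm n).inter (hD k)) ((hBm n).diff (hD k))
    rw [Set.inter_union_sdiff] at h3
    have h4 := norm_add_le (m (B n ∩ D k)) (m (B n \ D k))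
    rw [← h3] at h4
    linarith [hB n]
  choose g hg hgB using hnext
  set u : ℕ → ℕ := fun j => g^[j] 0
  have hu : ∀ j, u (j + 1) = g (u j) := fun j => Function.iterate_succ_apply' g j 0
  have hmono : StrictMono u := strictMono_nat_of_lt_succ fun j => by rw [hu]; exact hg _
  set C : ℕ → Set Ω := fun j => B (u j) \ D (u (j + 1)) with hC
  have hCm : ∀ j, MeasurableSet (C j) := fun j => (hBm _).diff (hD _)
  have hdisj : Pairwise (Function.onFun Disjoint C) := by
    refine (pairwise_disjoint_on C).2 fun i j hij => ?_
    refine Set.disjoint_left.2 fun x hi hj => hi.2 ?_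
    exact hanti (hmono.monotone hij) (hBD _ hj.1)
  have h0 := (m.m_iUnion hCm hdisj).summable.tendsto_atTop_zero.norm
  rw [norm_zero] at h0
  obtain ⟨j, hj⟩ := (h0.eventually (gt_mem_nhds (half_pos hε))).exists
  have := hgB (u j)
  rw [← hu] at this
  exact lt_asymm hj this

variable [NormedSpace ℝ E]

/-- Through this identity a bound by the norm of `L¹(m)`, tested on indicators, gives both countable
additivity and absolute continuity of the dominated measure. -/
lemma eNormLp_indicator_one {A : Set Ω} (hA : MeasurableSet A) :
    eNormLp m 1 (A.indicator fun _ => (1 : ℝ)) = m.semivariation A := by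
  unfold eNormLp VectorMeasure.semivariation
  have hball : {ℓ : StrongDual ℝ E | ‖ℓ‖ ≤ 1} = {ℓ | ‖ℓ‖ₑ ≤ 1} := by
    ext ℓ
    simp only [Set.mem_ofPred_eq, enorm_eq_nnnorm, ← NNReal.coe_le_coe, coe_nnnorm, NNReal.coe_one,
      ENNReal.coe_le_one_iff]
  rw [hball]
  congr! 3 with ℓ
  rw [ENNReal.coe_one, eLpNorm_one_eq_lintegral_enorm]
  simp only [enorm_indicator_eq_indicator_enorm, enorm_one]
  rw [lintegral_indicator hA]
  simp [scal]

/-- The semivariation of a countably additive vector measure is continuous at the empty set. -/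
lemma tendsto_semivariation_zero {D : ℕ → Set Ω} (hD : ∀ n, MeasurableSet (D n))
    (hanti : Antitone D) (hempty : ⋂ n, D n = ∅) :
    Tendsto (fun n => m.semivariation (D n)) atTop (𝓝 0) := by
  rw [ENNReal.tendsto_nhds_zero]
  intro ε hε
  -- The factor `2` is the loss in passing from the semivariation of a set to the norms of `m` on
  -- its measurable subsets (positive and negative parts of a real measure).
  obtain ⟨δ, hδ0, hδ⟩ : ∃ δ : ℝ, 0 < δ ∧ 2 * ENNReal.ofReal δ ≤ ε := by
    obtain ⟨r, hr0, hr⟩ := ENNReal.exists_nnreal_pos_mul_lt (a := 2) (by simp) hε.ne'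
    refine ⟨r, by exact_mod_cast hr0, ?_⟩
    rw [ENNReal.ofReal_coe_nnreal, mul_comm]
    exact hr.le
  obtain ⟨n, hn⟩ := exists_forall_subset_norm_le (m := m) hD hanti hempty hδ0
  filter_upwards [eventually_ge_atTop n] with k hk
  refine (VectorMeasure.semivariation_mono (hanti hk)).trans (not_lt.1 fun h => ?_)
  obtain ⟨t, hts, htm, ht⟩ :=
    VectorMeasure.exists_subset_lt_enorm_apply_of_lt_semivariation (hD n) h
  refine lt_irrefl _ (ht.trans_le (le_trans ?_ hδ))
  gcongr
  rw [← ofReal_norm]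
  exact ENNReal.ofReal_le_ofReal (hn t hts htm)

end Semivariation

/-! ### Norms of p-sums in scalar `L^p` spaces -/

lemma enorm_abs_rpow {p : ℝ≥0} (x : ℝ) : ‖|x| ^ (p : ℝ)‖ₑ = ‖x‖ₑ ^ (p : ℝ) := by
  rw [Real.enorm_of_nonneg (by positivity), ← Real.enorm_abs x, Real.enorm_of_nonneg (abs_nonneg _),
    ENNReal.ofReal_rpow_of_nonneg (abs_nonneg _) p.coe_nonneg]

section PSum

variable {Ω : Type*} [MeasurableSpace Ω] {E : Type*} [NormedAddCommGroup E] [NormedSpace ℝ E]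
  [CompleteSpace E] {m : VectorMeasure Ω E} {p : ℝ≥0} [Fact (1 ≤ (p : ℝ≥0∞))]

lemma coe_pos_of_fact : (0 : ℝ) < p := by
  exact_mod_cast lt_of_lt_of_le zero_lt_one (one_le_of_fact (p := p))

lemma eLpNorm_rpow_eq_lintegral {μ : Measure Ω} (f : Ω → ℝ) :
    eLpNorm f p μ ^ (p : ℝ) = ∫⁻ x, ‖f x‖ₑ ^ (p : ℝ) ∂μ := by
  have hp : p ≠ 0 := (lt_of_lt_of_le zero_lt_one (one_le_of_fact (p := p))).ne'
  exact eLpNorm_nnreal_pow_eq_lintegral hp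

lemma coeFn_pSum {n : ℕ} (f : Fin n → LpSpace m p) :
    LpSpace.pSum f =ᵐ[m.variation] fun x => (∑ i, |f i x| ^ (p : ℝ)) ^ (1 / (p : ℝ)) :=
  LpSpace.coeFn_mk _

/-- For a scalar measure the integral commutes with the finite sum, which fails for the supremum
defining the norm of `L^p(m)`. Both implications use this equality, in opposite directions. -/
lemma eLpNorm_pSum_rpow {κ : Measure Ω} (hκ : κ ≪ m.variation) {n : ℕ}
    (f : Fin n → LpSpace m p) :
    eLpNorm (LpSpace.pSum f) p κ ^ (p : ℝ) = ∑ i, eLpNorm (f i) p κ ^ (p : ℝ) := by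
  have hp0 := coe_pos_of_fact (p := p)
  simp only [eLpNorm_rpow_eq_lintegral]
  rw [← lintegral_finsetSum' _ fun i _ =>
    (((LpSpace.aesm (f i)).mono_ac hκ).enorm.pow_const _)]
  refine lintegral_congr_ae ?_
  filter_upwards [hκ.ae_eq (coeFn_pSum f)] with x hx
  have h0 : ∀ i ∈ Finset.univ, 0 ≤ |f i x| ^ (p : ℝ) := fun i _ => by positivity
  have h1 : 0 ≤ ∑ i, |f i x| ^ (p : ℝ) := Finset.sum_nonneg h0
  rw [hx, ← enorm_abs_rpow, abs_of_nonneg (by positivity), ← Real.rpow_mul h1,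
    one_div_mul_cancel hp0.ne', Real.rpow_one, Real.enorm_of_nonneg h1,
    ENNReal.ofReal_sum_of_nonneg h0]
  refine Finset.sum_congr rfl fun i hi => ?_
  rw [← enorm_abs_rpow, Real.enorm_of_nonneg (h0 i hi)]

lemma eLpNorm_one_abs_rpow {κ : Measure Ω} {f : Ω → ℝ} :
    eLpNorm (fun x => |f x| ^ (p : ℝ)) (1 : ℝ≥0) κ = eLpNorm f p κ ^ (p : ℝ) := by
  rw [eLpNorm_rpow_eq_lintegral, ENNReal.coe_one, eLpNorm_one_eq_lintegral_enorm]
  simp only [enorm_abs_rpow]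



lemma LpSpace.enorm_def (f : LpSpace m p) : ‖f‖ₑ = eNormLp m p f := by
  rw [← ofReal_norm f, LpSpace.norm_def, ENNReal.ofReal_toReal (LpSpace.eNormLp_lt_top f).ne]

end PSum

/-- Raised to the power `p`, both sides are sums over `j`, so bounds on single functions add up with
the same constant. -/
lemma eLpNorm_pSum_le {Ω Ω' E E' : Type*} [MeasurableSpace Ω] [MeasurableSpace Ω']
    [NormedAddCommGroup E] [NormedSpace ℝ E] [CompleteSpace E] [NormedAddCommGroup E']
    [NormedSpace ℝ E'] [CompleteSpace E'] {m : VectorMeasure Ω E} {m' : VectorMeasure Ω' E'}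
    {p : ℝ≥0} [Fact (1 ≤ (p : ℝ≥0∞))] {κ : Measure Ω} {κ' : Measure Ω'} (hκ : κ ≪ m.variation)
    (hκ' : κ' ≪ m'.variation) {D : ℝ≥0∞} {n : ℕ} {f : Fin n → LpSpace m p}
    {g : Fin n → LpSpace m' p} (h : ∀ j, eLpNorm (g j) p κ' ≤ D * eLpNorm (f j) p κ) :
    eLpNorm (LpSpace.pSum g) p κ' ≤ D * eLpNorm (LpSpace.pSum f) p κ := by
  have hp0 := coe_pos_of_fact (p := p)
  rw [← ENNReal.rpow_le_rpow_iff hp0, ENNReal.mul_rpow_of_nonneg _ _ hp0.le,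
    eLpNorm_pSum_rpow hκ', eLpNorm_pSum_rpow hκ, Finset.mul_sum]
  refine Finset.sum_le_sum fun j _ => ?_
  rw [← ENNReal.mul_rpow_of_nonneg _ _ hp0.le]
  exact ENNReal.rpow_le_rpow (h j) hp0.le

lemma enorm_apply_le_of_opNorm_le {X Y : Type*} [NormedAddCommGroup X] [NormedSpace ℝ X]
    [NormedAddCommGroup Y] [NormedSpace ℝ Y] {R : X →L[ℝ] Y} {C : ℝ} (hR : ‖R‖ ≤ C) (x : X) :
    ‖R x‖ₑ ≤ C.toNNReal * ‖x‖ₑ := by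
  change _ ≤ ENNReal.ofReal C * _
  rw [← ofReal_norm, ← ofReal_norm, ← ENNReal.ofReal_mul ((norm_nonneg R).trans hR)]
  exact ENNReal.ofReal_le_ofReal (R.le_of_opNorm_le hR x)

/-! ### The weights in `V` and the norm of `L^p(m_V)` -/

section Weight

variable {Ω : Type*} [MeasurableSpace Ω] {μ : Measure Ω}

instance (v : Ω →₁[μ] ℝ) : IsFiniteMeasure (weighted μ v) :=
  isFiniteMeasure_withDensity_ofReal (L1.integrable_coeFn v).2

variable {V : Set (Ω →₁[μ] ℝ)} {hpos : ∀ v ∈ V, 0 ≤ v} {hV : IsRelWeaklyCompact V}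

/-- The coordinate functional of `ℓ^∞(V)` at `v`. -/
noncomputable def coordFunctional (v : V) : StrongDual ℝ (lp (fun _ : V => ℝ) ∞) :=
  lp.evalCLM ℝ (fun _ : V => ℝ) ∞ v

lemma coordFunctional_apply (v : V) (x : lp (fun _ : V => ℝ) ∞) : coordFunctional v x = x v := rfl

lemma norm_coordFunctional_le (v : V) : ‖coordFunctional v‖ ≤ 1 :=
  ContinuousLinearMap.opNorm_le_bound _ zero_le_one fun x => by
    rw [one_mul]
    exact lp.norm_apply_le_norm ENNReal.top_ne_zero x v

lemma weightMeasure_apply {A : Set Ω} (hA : MeasurableSet A) (v : V) :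
    weightMeasure μ V hpos hV A v = ∫ x in A, v.1 x ∂μ := by
  classical
  change (if MeasurableSet A then (⟨fun v => ∫ x in A, v.1 x ∂μ, memlp_setInt hV A⟩ :
    lp (fun _ : V => ℝ) ∞) else 0) v = _
  rw [if_pos hA]

/-- Each weight is thus one of the scalar measures over which the norm of `L^p(m_V)` is a supremum.
Positivity of `v` matters: `weighted` truncates the density at zero. -/
lemma scal_coordFunctional (v : V) :
    scal (weightMeasure μ V hpos hV) (coordFunctional v) = (weighted μ v.1).toSignedMeasure := by
  ext A hA
  have h0 : 0 ≤ᵐ[μ.restrict A] v.1 := ae_restrict_of_ae ((Lp.coeFn_nonneg v.1).2 (hpos _ v.2))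
  rw [scal_apply, coordFunctional_apply, weightMeasure_apply hA,
    Measure.toSignedMeasure_apply_measurable hA, Measure.real, weighted, withDensity_apply _ hA,
    ← ofReal_integral_eq_lintegral_ofReal (L1.integrable_coeFn v.1).integrableOn h0,
    ENNReal.toReal_ofReal (integral_nonneg_of_ae h0)]

lemma variation_scal_coordFunctional (v : V) :
    (scal (weightMeasure μ V hpos hV) (coordFunctional v)).variation = weighted μ v.1 := by
  rw [scal_coordFunctional, Measure.variation_toSignedMeasure]

lemma weighted_ac (v : V) : weighted μ v.1 ≪ (weightMeasure μ V hpos hV).variation := by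
  rw [← variation_scal_coordFunctional (hpos := hpos) (hV := hV) v]
  exact scal_ac _ _

lemma eLpNorm_weighted_le (v : V) {p : ℝ≥0} (f : Ω → ℝ) :
    eLpNorm f p (weighted μ v.1) ≤ eNormLp (weightMeasure μ V hpos hV) p f := by
  rw [← variation_scal_coordFunctional (hpos := hpos) (hV := hV) v]
  exact eLpNorm_le_eNormLp (norm_coordFunctional_le v)

/-- Up to the factor `2`, the norm of `L¹(m_V)` is computed by the weights in `V`. -/
lemma eNormLp_one_weightMeasure_le {h : Ω → ℝ} (hh : MemL1 (weightMeasure μ V hpos hV) h) {c : ℝ≥0∞}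
    (hc : ∀ v ∈ V, eLpNorm h (1 : ℝ≥0) (weighted μ v) ≤ c) :
    eNormLp (weightMeasure μ V hpos hV) 1 h ≤ 2 * c := by
  rcases eq_or_ne c ∞ with rfl | hcfin
  · simp
  refine eNormLp_le fun ℓ hℓ => ?_
  have hint := hh.2.1
  -- An arbitrary `ℓ` is controlled through the vector `e = ∫_A h dm_V`: its norm in `ℓ^∞(V)` is
  -- computed coordinatewise, and the coordinate at `v` is the integral of `h` over `A` against `v
  -- dμ`.
  have hbound : ∀ A, MeasurableSet A → |∫ᵛ x in A, h x ∂<•(scal _ ℓ)| ≤ c.toReal := fun A hA => by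
    obtain ⟨e, he⟩ := hh.2.2 A hA
    rw [← he]
    refine (ℓ.le_opNorm e).trans ((mul_le_of_le_one_left (norm_nonneg _) hℓ).trans ?_)
    refine lp.norm_le_of_forall_le ENNReal.toReal_nonneg fun v => ?_
    rw [← coordFunctional_apply, he]
    refine (norm_setIntegral_le _ (hint _)).trans ?_
    rw [← ENNReal.ofReal_le_iff_le_toReal hcfin, ← eLpNorm_one_eq (hint _),
      variation_scal_coordFunctional]
    exact hc v.1 v.2
  -- The total variation integral is a difference of two set integrals, each at most `c` in absolute
  -- value; hence the factor `2`.
  obtain ⟨A, hA, hA'⟩ := exists_sign_set _ (hint ℓ)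
  rw [eLpNorm_one_eq (hint ℓ), hA', ← ENNReal.ofReal_toReal hcfin, ← ENNReal.ofReal_ofNat,
    ← ENNReal.ofReal_mul (by norm_num)]
  refine ENNReal.ofReal_le_ofReal ?_
  have h1 := abs_le.1 (hbound A hA)
  have h2 := abs_le.1 (hbound _ hA.compl)
  linarith [h1.2, h2.1]

lemma eNormLp_weightMeasure_le {p : ℝ≥0} (hp : 1 ≤ p) {h : Ω → ℝ}
    (hh : MemLp (weightMeasure μ V hpos hV) p h) {c : ℝ≥0∞}
    (hc : ∀ v ∈ V, eLpNorm h p (weighted μ v) ≤ c) :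
    eNormLp (weightMeasure μ V hpos hV) p h ≤ 2 * c := by
  have hp1 : (1 : ℝ) ≤ p := by exact_mod_cast hp
  have hp0 : (0 : ℝ) < p := by linarith
  have : Fact (1 ≤ (p : ℝ≥0∞)) := ⟨by exact_mod_cast hp⟩
  rw [← ENNReal.rpow_le_rpow_iff hp0, ← eNormLp_rpow (by exact_mod_cast hp0),
    ENNReal.mul_rpow_of_nonneg _ _ hp0.le]
  refine (eNormLp_one_weightMeasure_le hh.2 (c := c ^ (p : ℝ)) fun v hv => ?_).trans ?_
  · rw [eLpNorm_one_abs_rpow]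
    exact ENNReal.rpow_le_rpow (hc v hv) hp0.le
  -- The case of `L¹` applied to `|h|^p` gives `2 * c ^ p`, and `2 ≤ 2 ^ p`.
  · gcongr
    exact ENNReal.le_rpow_self_of_one_le (by norm_num) hp1

end Weight

/-! ### A Hahn–Banach sandwich theorem -/

/-- A sublinear functional `P` that dominates `q.2` at `q.1` for all `q` in a cone `Q` majorizes a
linear functional with the same property. -/
lemma exists_linearMap_le_sublinear_of_cone {X : Type*} [AddCommGroup X] [Module ℝ X] {P : X → ℝ}
    (hadd : ∀ x y, P (x + y) ≤ P x + P y) (hsmul : ∀ (c : ℝ≥0) x, P (c • x) = c * P x)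
    (Q : PointedCone ℝ (X × ℝ)) (hQ : ∀ q ∈ Q, q.2 ≤ P q.1) :
    ∃ φ : X →ₗ[ℝ] ℝ, (∀ x, φ x ≤ P x) ∧ ∀ q ∈ Q, q.2 ≤ φ q.1 := by
  have hP0 : P 0 = 0 := by simpa using hsmul 0 0
  -- Essentially the epigraph of `x ↦ inf_q (P (q.1 + x) - q.2)`. A functional `g` that is
  -- nonnegative on `s` and satisfies `g (0, t) = t` encodes a linear minorant of this infimum,
  -- namely `-g (·, 0)`.
  let s : PointedCone ℝ (X × ℝ) :=
    { carrier := {z | ∃ q ∈ Q, P (q.1 + z.1) - q.2 ≤ z.2}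
      add_mem' := by
        rintro z w ⟨q, hq, hz⟩ ⟨r, hr, hw⟩
        refine ⟨q + r, Q.add_mem hq hr, ?_⟩
        have := hadd (q.1 + z.1) (r.1 + w.1)
        rw [add_add_add_comm] at this
        simp only [Prod.fst_add, Prod.snd_add]
        linarith
      zero_mem' := ⟨0, Q.zero_mem, by simp [hP0]⟩
      smul_mem' := by
        rintro c z ⟨q, hq, hz⟩
        refine ⟨c • q, Submodule.smul_mem Q c hq, ?_⟩
        have h1 : P ((c • q).1 + (c • z).1) = c * P (q.1 + z.1) := by
          rw [Prod.smul_fst, Prod.smul_fst, ← smul_add]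
          exact hsmul c _
        rw [h1]
        have h2 : (c • q).2 = c * q.2 := rfl
        have h3 : (c • z).2 = c * z.2 := rfl
        rw [h2, h3, ← mul_sub]
        exact mul_le_mul_of_nonneg_left hz c.2 }
  have hs : ∀ z : X × ℝ, z ∈ s ↔ ∃ q ∈ Q, P (q.1 + z.1) - q.2 ≤ z.2 := fun _ => Iff.rfl
  let f : X × ℝ →ₗ.[ℝ] ℝ :=
    { domain := LinearMap.ker (LinearMap.fst ℝ X ℝ)
      toFun := (LinearMap.snd ℝ X ℝ).comp (Submodule.subtype _) }
  obtain ⟨g, hgf, hgs⟩ := riesz_extension s f (by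
      rintro ⟨⟨x, t⟩, hx⟩ hmem
      obtain ⟨q, hq, h⟩ := (hs _).1 hmem
      have hx0 : x = 0 := hx
      subst hx0
      rw [add_zero] at h
      have := hQ q hq
      change (0 : ℝ) ≤ t
      have h' : P q.1 - q.2 ≤ t := h
      linarith) (by
      rintro ⟨x, t⟩
      refine ⟨⟨(0, P x - t), LinearMap.mem_ker.2 rfl⟩, (hs _).2 ⟨0, Q.zero_mem, ?_⟩⟩
      simp)
  have hg : ∀ x t, g (x, t) = t + g (x, 0) := fun x t => by
    have h1 : g (0, t) = t := hgf ⟨(0, t), LinearMap.mem_ker.2 rfl⟩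
    have h2 : ((x, t) : X × ℝ) = (0, t) + (x, 0) := by simp
    rw [h2, map_add, h1]
  -- The two inequalities are nonnegativity of `g` at `(x, P x)`, witnessed by `0 ∈ Q`, and at
  -- `(-q.1, -q.2)`, witnessed by `q` itself.
  refine ⟨-(g.comp (LinearMap.inl ℝ X ℝ)), fun x => ?_, fun q hq => ?_⟩
  · have h1 := hgs (x, P x) ((hs _).2 ⟨0, Q.zero_mem, by simp⟩)
    rw [hg] at h1
    simp only [LinearMap.neg_apply, LinearMap.comp_apply, LinearMap.inl_apply]
    linarith
  · have h1 := hgs (-q.1, -q.2) ((hs _).2 ⟨q, hq, by simp [hP0]⟩)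
    have h2 : g (-q.1, 0) = - g (q.1, 0) := by
      rw [← map_neg]; simp
    rw [hg, h2] at h1
    simp only [LinearMap.neg_apply, LinearMap.comp_apply, LinearMap.inl_apply]
    linarith

/-! ### Representation of dominated functionals by measures -/

section Measure

variable {Ω : Type*} [MeasurableSpace Ω] {E : Type*} [NormedAddCommGroup E] [NormedSpace ℝ E]
  {m : VectorMeasure Ω E}

lemma memL1_simpleFunc [CompleteSpace E] (s : SimpleFunc Ω ℝ) : MemL1 m s := by
  obtain ⟨C, hC⟩ := s.exists_forall_norm_le
  refine (MemL1.const C).mono s.stronglyMeasurable.aestronglyMeasurable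
    (Eventually.of_forall fun x => (hC x).trans (le_abs_self _))

lemma simpleFunc_restrict_union {A B : Set Ω} (hA : MeasurableSet A) (hB : MeasurableSet B)
    (hAB : Disjoint A B) (f : SimpleFunc Ω ℝ) :
    f.restrict (A ∪ B) = f.restrict A + f.restrict B := by
  ext x
  rw [SimpleFunc.coe_add, SimpleFunc.coe_restrict _ (hA.union hB), SimpleFunc.coe_restrict _ hA,
    SimpleFunc.coe_restrict _ hB, Set.indicator_union_of_disjoint hAB]
  rfl

/-- A linear functional on the simple functions that is dominated by the positive part of the norm of
`L¹(m)` is the integral with respect to a finite measure. -/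
lemma exists_measure_of_le_eNormLp [CompleteSpace E] (φ : SimpleFunc Ω ℝ →ₗ[ℝ] ℝ)
    (hφ : ∀ s, φ s ≤ (eNormLp m 1 fun x => max (s x) 0).toReal) :
    ∃ κ : Measure Ω, IsFiniteMeasure κ ∧ ∀ s : SimpleFunc Ω ℝ, ∫ x, s x ∂κ = φ s := by
  set χ : Set Ω → SimpleFunc Ω ℝ := fun A => (SimpleFunc.const Ω (1 : ℝ)).restrict A with hχdef
  have hχ : ∀ A, MeasurableSet A → ⇑(χ A) = A.indicator fun _ => (1 : ℝ) := fun A hA =>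
    SimpleFunc.coe_restrict _ hA
  -- Domination by the positive part forces positivity: for `s ≥ 0` the positive part of `-s`
  -- vanishes, so `φ (-s) ≤ 0`.
  have hnonneg : ∀ s : SimpleFunc Ω ℝ, (∀ x, 0 ≤ s x) → 0 ≤ φ s := fun s hs => by
    have h1 := hφ (-s)
    have h2 : (fun x => max ((-s) x) 0) = (0 : ℝ) • (0 : Ω → ℝ) := by
      funext x
      simpa using hs x
    rw [h2, eNormLp_smul] at h1
    simpa using h1
  have hχ0 : ∀ A, 0 ≤ φ (χ A) := fun A => hnonneg _ fun x => by
    by_cases hA : MeasurableSet A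
    -- Off the measurable sets, `SimpleFunc.restrict` is zero by convention, so the bound holds for
    -- every `A`.
    · rw [hχ A hA]; exact Set.indicator_nonneg (fun _ _ => zero_le_one) x
    · simp [χ, SimpleFunc.restrict_of_not_measurable hA]
  have hχle : ∀ A, MeasurableSet A → φ (χ A) ≤ (m.semivariation A).toReal := fun A hA => by
    rw [← eNormLp_indicator_one hA]
    convert hφ (χ A) using 4 with x
    rw [hχ A hA, max_eq_left (Set.indicator_nonneg (fun _ _ => zero_le_one) x)]
  have hunion : ∀ A B, MeasurableSet A → MeasurableSet B → Disjoint A B →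
      φ (χ (A ∪ B)) = φ (χ A) + φ (χ B) := fun A B hA hB hAB => by
    rw [← map_add]
    exact congrArg φ (simpleFunc_restrict_union hA hB hAB _)
  have hempty : φ (χ ∅) = 0 := by simp [χ]
  have hsum : ∀ A : ℕ → Set Ω, (∀ i, MeasurableSet (A i)) → Pairwise (Function.onFun Disjoint A) →
      HasSum (fun i => φ (χ (A i))) (φ (χ (⋃ i, A i))) := fun A hA hd => by
    rw [hasSum_iff_tendsto_nat_of_nonneg fun i => hχ0 _]
    set G : ℕ → Set Ω := fun n => ⋃ i ∈ Finset.range n, A i with hG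
    have hGm : ∀ n, MeasurableSet (G n) := fun n =>
      Finset.measurableSet_biUnion _ fun i _ => hA i
    have hUm : MeasurableSet (⋃ i, A i) := MeasurableSet.iUnion hA
    have hGsub : ∀ n, G n ⊆ ⋃ i, A i := fun n => Set.iUnion₂_subset fun i _ =>
      Set.subset_iUnion A i
    have hGsum : ∀ n, ∑ i ∈ Finset.range n, φ (χ (A i)) = φ (χ (G n)) := fun n => by
      induction n with
      | zero => simp [G, hempty]
      | succ n ih =>
        have h1 : G (n + 1) = G n ∪ A n := by
          ext x
          simp only [G, Set.mem_iUnion, Finset.mem_range, Set.mem_union, Nat.lt_succ_iff_lt_or_eq]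
          aesop
        have h2 : Disjoint (G n) (A n) := by
          simp only [G, Set.disjoint_iUnion_left, Finset.mem_range]
          exact fun i hi => hd hi.ne
        rw [Finset.sum_range_succ, ih, h1, hunion _ _ (hGm n) (hA n) h2]
    have hdiff : ∀ n, ∑ i ∈ Finset.range n, φ (χ (A i))
        = φ (χ (⋃ i, A i)) - φ (χ ((⋃ i, A i) \ G n)) := fun n => by
      have h1 := hunion (G n) ((⋃ i, A i) \ G n) (hGm n) (hUm.diff (hGm n))
        Set.disjoint_sdiff_right
      rw [Set.union_sdiff_cancel (hGsub n)] at h1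
      rw [hGsum, h1]; ring
    simp only [hdiff]
    -- The remainders decrease to the empty set, so their semivariations, which dominate `φ`, tend
    -- to zero.
    have hlim : Tendsto (fun n => φ (χ ((⋃ i, A i) \ G n))) atTop (𝓝 0) := by
      have h1 := tendsto_semivariation_zero (m := m) (D := fun n => (⋃ i, A i) \ G n)
        (fun n => hUm.diff (hGm n)) (fun a b hab => Set.sdiff_subset_sdiff_right
          (Set.biUnion_subset_biUnion_left fun i hi =>
            Finset.mem_range.2 ((Finset.mem_range.1 hi).trans_le hab))) (by
          refine Set.eq_empty_of_forall_notMem fun x hx => ?_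
          rw [Set.mem_iInter] at hx
          obtain ⟨i, hi⟩ := Set.mem_iUnion.1 (hx 0).1
          exact (hx (i + 1)).2 (Set.mem_biUnion (Finset.mem_coe.2 (Finset.self_mem_range_succ i)) hi))
      refine squeeze_zero (fun n => hχ0 _) (fun n => hχle _ (hUm.diff (hGm n))) ?_
      exact (ENNReal.tendsto_toReal ENNReal.zero_ne_top).comp h1
    simpa using hlim.const_sub (φ (χ (⋃ i, A i)))
  let κ : Measure Ω := Measure.ofMeasurable (fun A _ => ENNReal.ofReal (φ (χ A)))
    (by rw [hempty, ENNReal.ofReal_zero]) (fun A hA hd => by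
      rw [← (hsum A hA hd).tsum_eq, ENNReal.ofReal_tsum_of_nonneg (fun i => hχ0 _)
        (hsum A hA hd).summable])
  have hκ : ∀ A, MeasurableSet A → κ A = ENNReal.ofReal (φ (χ A)) := fun A hA =>
    Measure.ofMeasurable_apply A hA
  have hfin : IsFiniteMeasure κ := ⟨by
    rw [hκ _ MeasurableSet.univ]; exact ENNReal.ofReal_lt_top⟩
  refine ⟨κ, hfin, fun s => ?_⟩
  induction s using SimpleFunc.induction with
  | @const c A hA =>
    have h1 : SimpleFunc.piecewise A hA (SimpleFunc.const Ω c) (SimpleFunc.const Ω 0) = c • χ A := by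
      ext x
      rw [SimpleFunc.coe_smul, hχ A hA]
      by_cases hx : x ∈ A <;> simp [hx]
    rw [h1, map_smul, SimpleFunc.coe_smul, hχ A hA]
    simp only [Pi.smul_apply, integral_smul]
    rw [integral_indicator_const _ hA, Measure.real, hκ A hA, ENNReal.toReal_ofReal (hχ0 A)]
    simp
  | @add f g _ hf hg =>
    rw [map_add, ← hf, ← hg]
    simp only [SimpleFunc.coe_add, Pi.add_apply]
    exact integral_add (f.integrable_of_isFiniteMeasure) (g.integrable_of_isFiniteMeasure)

/-- The lower integral is a supremum over nonnegative simple `s ≤ |f|`. Each such `s` is its own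
positive part, so `φ s` is at most its norm in `L¹(m)`, and the norm is monotone. -/
lemma lintegral_enorm_le_eNormLp [CompleteSpace E] {φ : SimpleFunc Ω ℝ →ₗ[ℝ] ℝ}
    (hφ : ∀ s, φ s ≤ (eNormLp m 1 fun x => max (s x) 0).toReal) {κ : Measure Ω}
    [IsFiniteMeasure κ] (hκ : ∀ s : SimpleFunc Ω ℝ, ∫ x, s x ∂κ = φ s) (f : Ω → ℝ) :
    ∫⁻ x, ‖f x‖ₑ ∂κ ≤ eNormLp m 1 f := by
  rw [lintegral_eq_nnreal]
  refine iSup₂_le fun g hg => ?_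
  set s : SimpleFunc Ω ℝ := g.map ((↑) : ℝ≥0 → ℝ) with hs
  have hs0 : ∀ x, s x = g x := fun x => rfl
  have h1 : (g.map ((↑) : ℝ≥0 → ℝ≥0∞)).lintegral κ = ENNReal.ofReal (∫ x, s x ∂κ) := by
    rw [← SimpleFunc.lintegral_eq_lintegral, ofReal_integral_eq_lintegral_ofReal
      s.integrable_of_isFiniteMeasure (Eventually.of_forall fun x => (g x).coe_nonneg)]
    refine lintegral_congr fun x => ?_
    rw [hs0, ENNReal.ofReal_coe_nnreal]; rfl
  rw [h1, hκ]
  refine (ENNReal.ofReal_le_ofReal (hφ s)).trans (ENNReal.ofReal_toReal_le.trans ?_)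
  refine eNormLp_mono (Eventually.of_forall fun x => ?_)
  rw [hs0, max_eq_left (g x).coe_nonneg, abs_of_nonneg (g x).coe_nonneg]
  have := hg x
  rw [← Real.enorm_abs, Real.enorm_of_nonneg (abs_nonneg _), ← ENNReal.ofReal_coe_nnreal,
    ENNReal.ofReal_le_ofReal_iff (abs_nonneg _)] at this
  exact this

end Measure

/-! ### Domination by a measure, and extension from simple functions -/

section Factorization

variable {Λ : Type*} [MeasurableSpace Λ] {E : Type*} [NormedAddCommGroup E] [NormedSpace ℝ E]
  {m : VectorMeasure Λ E} {p : ℝ≥0}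

lemma integral_congr {f g : Λ → ℝ} (hf : MemL1 m f) (h : f =ᵐ[m.variation] g) :
    integral m f = integral m g := by
  refine (SeparatingDual.eq_iff_forall_dual_eq (R := ℝ)).2 fun ℓ => ?_
  rw [integral_spec hf, integral_spec (hf.congr h)]
  exact VectorMeasure.integral_congr_ae ((scal_ac m ℓ).ae_eq h)

/-- Tested on indicators, the hypothesis bounds `κ` by the semivariation, hence by the variation. -/
lemma absolutelyContinuous_of_lintegral_le {κ : Measure Λ}
    (hκ : ∀ f : Λ → ℝ, ∫⁻ x, ‖f x‖ₑ ∂κ ≤ eNormLp m 1 f) : κ ≪ m.variation := by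
  refine Measure.AbsolutelyContinuous.mk fun A hA h0 => ?_
  have h1 := hκ (A.indicator fun _ => 1)
  rw [eNormLp_indicator_one hA] at h1
  simp only [enorm_indicator_eq_indicator_enorm, enorm_one] at h1
  rw [lintegral_indicator hA, lintegral_one, Measure.restrict_apply_univ] at h1
  exact le_antisymm (h1.trans (VectorMeasure.semivariation_le_variation.trans h0.le)) zero_le

variable [CompleteSpace E]

/-- A bound for an operator composed with the integral extends from simple functions to `L^p(m)`. -/
lemma enorm_apply_integral_le_of_simpleFunc {Y : Type*} [NormedAddCommGroup Y] [NormedSpace ℝ Y]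
    (hp : 1 ≤ p) {κ : Measure Λ} (hκ : κ ≪ m.variation) {K : ℝ≥0} {R : E →L[ℝ] Y}
    (h : ∀ s : SimpleFunc Λ ℝ, ‖R (integral m s)‖ₑ ≤ K * eLpNorm s p κ) {f : Λ → ℝ}
    (hf : MemLp m p f) (hfκ : eLpNorm f p κ < ∞) :
    ‖R (integral m f)‖ₑ ≤ K * eLpNorm f p κ := by
  have hff := hf.1.ae_eq_mk
  have hmeas : Measurable (hf.1.mk f) := hf.1.stronglyMeasurable_mk.measurable
  rw [integral_congr (hf.memL1 hp) hff, eLpNorm_congr_ae (hκ.ae_eq hff)]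
  rw [eLpNorm_congr_ae (hκ.ae_eq hff)] at hfκ
  have hf1 : MemL1 m (hf.1.mk f) := (hf.memL1 hp).congr hff
  generalize hf.1.mk f = g at hmeas hfκ hf1
  obtain ⟨s, hs⟩ : ∃ s : ℕ → SimpleFunc Λ ℝ,
      s = SimpleFunc.approxOn g hmeas Set.univ 0 (Set.mem_univ _) := ⟨_, rfl⟩
  have hlim : ∀ x, Tendsto (fun n => s n x) atTop (𝓝 (g x)) := fun x => by
    rw [hs]; exact SimpleFunc.tendsto_approxOn hmeas _ (by simp)
  have hbd : ∀ n x, ‖s n x‖ ≤ ‖g x‖ + ‖g x‖ := fun n x => by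
    rw [hs]; exact SimpleFunc.norm_approxOn_zero_le hmeas _ x n
  have hLp : Tendsto (fun n => eLpNorm (⇑(s n) - g) p κ) atTop (𝓝 0) := by
    rw [hs]
    exact SimpleFunc.tendsto_approxOn_Lp_eLpNorm hmeas _ ENNReal.coe_ne_top (by simp)
      (by simpa using hfκ)
  -- Dominated convergence is applied only to the scalar measure `⟨m, y ∘ R⟩`. With `y` norming the
  -- limit vector, this suffices to pass to the limit in the bound.
  obtain ⟨y, hy1, hy2⟩ := exists_dual_vector'' ℝ (R (integral m g))
  have hw : Tendsto (fun n => (y.comp R) (integral m (s n))) atTop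
      (𝓝 ((y.comp R) (integral m g))) := by
    simp only [integral_spec hf1, integral_spec (memL1_simpleFunc (s _))]
    refine VectorMeasure.tendsto_integral_of_dominated_convergence (fun x => ‖g x‖ + ‖g x‖)
      (fun n => (s n).stronglyMeasurable.aestronglyMeasurable) ?_
      (fun n => Eventually.of_forall fun x => hbd n x) (Eventually.of_forall fun x => hlim x)
    exact (hf1.2.1 _).norm.add (hf1.2.1 _).norm
  have hw' : Tendsto (fun n => ‖(y.comp R) (integral m (s n))‖ₑ) atTop
      (𝓝 ‖R (integral m g)‖ₑ) := by
    have h1 : ‖(y.comp R) (integral m g)‖ₑ = ‖R (integral m g)‖ₑ := by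
      rw [ContinuousLinearMap.comp_apply, hy2]
      simp
    rw [← h1]
    exact hw.enorm
  have hb : Tendsto (fun n => (K : ℝ≥0∞) * (eLpNorm (⇑(s n) - g) p κ + eLpNorm g p κ)) atTop
      (𝓝 (K * (0 + eLpNorm g p κ))) :=
    ENNReal.Tendsto.const_mul (hLp.add_const _) (Or.inr ENNReal.coe_ne_top)
  rw [zero_add] at hb
  refine le_of_tendsto_of_tendsto' hw' hb fun n => ?_
  have h1 : ‖(y.comp R) (integral m (s n))‖ₑ ≤ ‖R (integral m (s n))‖ₑ := by
    rw [ContinuousLinearMap.comp_apply]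
    refine (enorm_apply_le_of_opNorm_le hy1 _).trans_eq (by simp)
  refine h1.trans ((h (s n)).trans ?_)
  gcongr
  have h2 : ⇑(s n) = (⇑(s n) - g) + g := by simp
  conv_lhs => rw [h2]
  exact eLpNorm_add_le ((s n).stronglyMeasurable.sub hmeas.stronglyMeasurable).aestronglyMeasurable
    hmeas.aestronglyMeasurable (by exact_mod_cast hp)

variable [Fact (1 ≤ (p : ℝ≥0∞))]

/-- A measure `κ` with `‖f‖_{L^p(κ)} ≤ ‖f‖_{L^p(m)}` admits a formal identity `L^p(m) → L^p(κ)`. -/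
lemma exists_formalIdentity {κ : Measure Λ} (hκ : κ ≪ m.variation)
    (h : ∀ f : Λ → ℝ, eLpNorm f p κ ≤ eNormLp m p f) :
    ∃ i : LpSpace m p →L[ℝ] Lp ℝ p κ, (∀ f, i f =ᵐ[κ] f) ∧ ‖i‖ ≤ 1 := by
  have hmem : ∀ f : LpSpace m p, MeasureTheory.MemLp f p κ := fun f =>
    ⟨(LpSpace.aesm f).mono_ac hκ, (h f).trans_lt (LpSpace.eNormLp_lt_top f)⟩
  let i : LpSpace m p →ₗ[ℝ] Lp ℝ p κ :=
    { toFun f := (hmem f).toLp f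
      map_add' f g := by
        rw [← MeasureTheory.MemLp.toLp_add, MeasureTheory.MemLp.toLp_eq_toLp_iff]
        exact hκ.ae_eq (LpSpace.coeFn_add f g)
      map_smul' c f := by
        rw [RingHom.id_apply, ← MeasureTheory.MemLp.toLp_const_smul,
          MeasureTheory.MemLp.toLp_eq_toLp_iff]
        exact hκ.ae_eq (LpSpace.coeFn_smul c f) }
  have hi : ∀ f, i f =ᵐ[κ] f := fun f => (hmem f).coeFn_toLp
  refine ⟨i.mkContinuous 1 fun f => ?_, hi, i.mkContinuous_norm_le zero_le_one _⟩
  rw [one_mul, Lp.norm_def, eLpNorm_congr_ae (hi f), LpSpace.norm_def]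
  exact ENNReal.toReal_mono (LpSpace.eNormLp_lt_top f).ne (h f)

/-- The class in `L^p(m)` of a simple function. -/
noncomputable def LpSpace.ofSimpleFunc (m : VectorMeasure Λ E) (p : ℝ≥0) [Fact (1 ≤ (p : ℝ≥0∞))]
    (s : SimpleFunc Λ ℝ) : LpSpace m p :=
  LpSpace.mk s ⟨s.stronglyMeasurable.aestronglyMeasurable,
    memL1_simpleFunc (s.map fun x : ℝ => |x| ^ (p : ℝ))⟩

lemma LpSpace.coeFn_ofSimpleFunc (s : SimpleFunc Λ ℝ) :
    LpSpace.ofSimpleFunc m p s =ᵐ[m.variation] s :=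
  LpSpace.coeFn_mk _

lemma LpSpace.ofSimpleFunc_smul (c : ℝ) (s : SimpleFunc Λ ℝ) :
    LpSpace.ofSimpleFunc m p (c • s) = c • LpSpace.ofSimpleFunc m p s := by
  refine Subtype.ext (AEEqFun.ext ?_)
  refine (coeFn_ofSimpleFunc _).trans (EventuallyEq.trans ?_ (coeFn_smul c _).symm)
  filter_upwards [coeFn_ofSimpleFunc (m := m) (p := p) s] with x hx
  simp [hx]

/-- The simple functions are dense in `L^p(κ)`. -/
lemma denseRange_of_coeFn_eq {κ : Measure Λ} (hκ : κ ≪ m.variation)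
    {i : LpSpace m p → Lp ℝ p κ} (hi : ∀ f, i f =ᵐ[κ] f) : DenseRange i := by
  refine (Lp.simpleFunc.dense (E := ℝ) (μ := κ) (p := p) ENNReal.coe_ne_top).mono fun g hg => ?_
  refine ⟨LpSpace.ofSimpleFunc m p (Lp.simpleFunc.toSimpleFunc ⟨g, hg⟩), ?_⟩
  refine Lp.ext ((hi _).trans ((hκ.ae_eq (LpSpace.coeFn_ofSimpleFunc _)).trans ?_))
  exact Lp.simpleFunc.toSimpleFunc_eq_toFun ⟨g, hg⟩

lemma simpleFunc_sum_apply {ι : Type*} (t : Finset ι) (F : ι → SimpleFunc Λ ℝ) (x : Λ) :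
    (∑ i ∈ t, F i) x = ∑ i ∈ t, F i x := by
  classical
  induction t using Finset.induction_on with
  | empty => simp
  | insert a t ha ih => rw [Finset.sum_insert ha, Finset.sum_insert ha, ← ih]; rfl

/-- If `∑ ‖T sᵢ‖^p ≤ ‖∑ |sᵢ|^p‖_{L¹(m)}` for all simple functions, then `‖T s‖^p ≤ ∫ |s|^p dκ` for some
`κ` in the dual unit ball. -/
lemma exists_measure_of_pSum_le {Y : Type*} [NormedAddCommGroup Y] [NormedSpace ℝ Y]
    (T : SimpleFunc Λ ℝ → Y) (hT : ∀ (c : ℝ) s, T (c • s) = c • T s)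
    (h : ∀ (n : ℕ) (s : Fin n → SimpleFunc Λ ℝ),
      ∑ i, ‖T (s i)‖ ^ (p : ℝ) ≤ (eNormLp m 1 fun x => ∑ i, |s i x| ^ (p : ℝ)).toReal) :
    ∃ κ : Measure Λ, IsFiniteMeasure κ ∧ (∀ f : Λ → ℝ, ∫⁻ x, ‖f x‖ₑ ∂κ ≤ eNormLp m 1 f) ∧
      ∀ s, ‖T s‖ₑ ≤ eLpNorm s p κ := by
  have hp0 := coe_pos_of_fact (p := p)
  -- The positive part makes every linear functional below `P` positive.
  set P : SimpleFunc Λ ℝ → ℝ := fun s => (eNormLp m 1 fun x => max (s x) 0).toReal with hP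
  have hfin : ∀ s : SimpleFunc Λ ℝ, eNormLp m 1 (fun x => max (s x) 0) ≠ ∞ := fun s =>
    (memL1_simpleFunc (m := m) (s.map fun x => max x 0)).eNormLp_lt_top.ne
  have hadd : ∀ s t, P (s + t) ≤ P s + P t := fun s t => by
    rw [hP]
    simp only
    rw [← ENNReal.toReal_add (hfin s) (hfin t)]
    refine ENNReal.toReal_mono (ENNReal.add_ne_top.2 ⟨hfin s, hfin t⟩) ?_
    refine (eNormLp_mono (Eventually.of_forall fun x => ?_)).trans (eNormLp_add_le (by simp)
      (memL1_simpleFunc (m := m) (s.map fun x => max x 0)).1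
      (memL1_simpleFunc (m := m) (t.map fun x => max x 0)).1)
    change |max (s x + t x) 0| ≤ |max (s x) 0 + max (t x) 0|
    rw [abs_of_nonneg (le_max_right _ _), abs_of_nonneg (by positivity)]
    exact max_le (add_le_add (le_max_left _ _) (le_max_left _ _)) (by positivity)
  have hsmul : ∀ (c : ℝ≥0) s, P (c • s) = c * P s := fun c s => by
    have h1 : (fun x => max ((c • s) x) 0) = (c : ℝ) • fun x => max (s x) 0 := by
      funext x
      change max ((c : ℝ) * s x) 0 = c * max (s x) 0
      rw [mul_max_of_nonneg _ _ c.coe_nonneg, mul_zero]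
    simp only [hP]
    rw [h1, eNormLp_smul, ENNReal.toReal_mul, toReal_enorm, Real.norm_of_nonneg c.coe_nonneg]
  let a : SimpleFunc Λ ℝ → SimpleFunc Λ ℝ := fun s => s.map fun x : ℝ => |x| ^ (p : ℝ)
  -- The cone of pairs `(∑ |s_i|^p, ∑ ‖T s_i‖^p)`: sums concatenate families, and scaling by `c`
  -- multiplies each `s_i` by `c^{1/p}`. Only homogeneity of `T` enters; additivity is not needed.
  let Q : PointedCone ℝ (SimpleFunc Λ ℝ × ℝ) :=
    { carrier := {q | ∃ (n : ℕ) (s : Fin n → SimpleFunc Λ ℝ),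
        q.1 = ∑ i, a (s i) ∧ q.2 = ∑ i, ‖T (s i)‖ ^ (p : ℝ)}
      add_mem' := by
        rintro q r ⟨n, s, hs, hs'⟩ ⟨k, t, ht, ht'⟩
        refine ⟨n + k, Fin.append s t, ?_, ?_⟩
        · simp [Fin.sum_univ_add, hs, ht]
        · simp [Fin.sum_univ_add, hs', ht']
      zero_mem' := ⟨0, Fin.elim0, by simp, by simp⟩
      smul_mem' := by
        rintro c q ⟨n, s, hs, hs'⟩
        have hc : ((c : ℝ) ^ (1 / (p : ℝ))) ^ (p : ℝ) = c := by
          rw [← Real.rpow_mul c.2, one_div_mul_cancel hp0.ne', Real.rpow_one]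
        have hc0 : 0 ≤ (c : ℝ) ^ (1 / (p : ℝ)) := Real.rpow_nonneg c.2 _
        refine ⟨n, fun i => ((c : ℝ) ^ (1 / (p : ℝ))) • s i, ?_, ?_⟩
        · have h1 : (c • q).1 = (c : ℝ) • q.1 := rfl
          rw [h1, hs, Finset.smul_sum]
          refine Finset.sum_congr rfl fun i _ => ?_
          ext x
          change (c : ℝ) * |s i x| ^ (p : ℝ) = |(c : ℝ) ^ (1 / (p : ℝ)) * s i x| ^ (p : ℝ)
          rw [abs_mul, abs_of_nonneg hc0, Real.mul_rpow hc0 (abs_nonneg _), hc]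
        · have h1 : (c • q).2 = (c : ℝ) * q.2 := rfl
          rw [h1, hs', Finset.mul_sum]
          refine Finset.sum_congr rfl fun i _ => ?_
          rw [hT, norm_smul, Real.norm_of_nonneg hc0, Real.mul_rpow hc0 (norm_nonneg _), hc] }
  obtain ⟨φ, hφP, hφQ⟩ := exists_linearMap_le_sublinear_of_cone hadd hsmul Q (by
    rintro q ⟨n, s, hs, hs'⟩
    rw [hs, hs']
    refine (h n s).trans_eq ?_
    simp only [hP]
    congr 2
    funext x
    have h1 : (∑ i, a (s i)) x = ∑ i, |s i x| ^ (p : ℝ) := by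
      simp only [simpleFunc_sum_apply]
      rfl
    rw [h1, max_eq_left (Finset.sum_nonneg fun i _ => by positivity)])
  obtain ⟨κ, hκfin, hκ⟩ := exists_measure_of_le_eNormLp φ hφP
  refine ⟨κ, hκfin, lintegral_enorm_le_eNormLp hφP hκ, fun s => ?_⟩
  -- Families of length one recover the pointwise domination.
  have h1 : ‖T s‖ ^ (p : ℝ) ≤ φ (a s) := by
    refine hφQ (a s, ‖T s‖ ^ (p : ℝ)) ⟨1, fun _ => s, ?_, ?_⟩ <;> simp
  rw [← ENNReal.rpow_le_rpow_iff hp0, ← eLpNorm_one_abs_rpow]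
  rw [show eLpNorm (fun x => |s x| ^ (p : ℝ)) (1 : ℝ≥0) κ = _ from
    eLpNorm_one_eq (a s).integrable_of_isFiniteMeasure, ← ofReal_norm,
    ENNReal.ofReal_rpow_of_nonneg (norm_nonneg _) hp0.le]
  refine ENNReal.ofReal_le_ofReal (h1.trans_eq ?_)
  rw [← hκ]
  refine MeasureTheory.integral_congr_ae (Eventually.of_forall fun x => ?_)
  exact (abs_of_nonneg (Real.rpow_nonneg (abs_nonneg (s x)) p)).symm

end Factorization

/-! ### Maurey–Rosenthal factorization of the integration map -/

section Factorization

variable {Λ : Type*} [MeasurableSpace Λ] {p : ℝ≥0} [Fact (1 ≤ (p : ℝ≥0∞))]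

/-- The left side is exactly the p-th power of the norm of the p-sum in `L^p(κ)`. This turns the
lattice inequality of `p`-regularity into one on the norms of the images, as the separation argument
requires. -/
lemma sum_rpow_norm_le {Ω E : Type*} [MeasurableSpace Ω] [NormedAddCommGroup E]
    [NormedSpace ℝ E] [CompleteSpace E] {n : VectorMeasure Ω E} {κ : Measure Ω}
    (hκ : κ ≪ n.variation) (hle : ∀ f : Ω → ℝ, eLpNorm f p κ ≤ eNormLp n p f)
    {R : LpSpace n p →L[ℝ] Lp ℝ p κ} (hR : ∀ f, R f =ᵐ[κ] f) {k : ℕ} (g : Fin k → LpSpace n p) :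
    ∑ i, ‖R (g i)‖ ^ (p : ℝ) ≤ ‖LpSpace.pSum g‖ ^ (p : ℝ) := by
  have hp0 := coe_pos_of_fact (p := p)
  rw [← ENNReal.ofReal_le_ofReal_iff (by positivity),
    ENNReal.ofReal_sum_of_nonneg fun i _ => by positivity,
    ← ENNReal.ofReal_rpow_of_nonneg (norm_nonneg _) hp0.le, ofReal_norm, LpSpace.enorm_def]
  refine le_trans (le_of_eq ?_) (ENNReal.rpow_le_rpow (hle _) hp0.le)
  rw [eLpNorm_pSum_rpow hκ]
  refine Finset.sum_congr rfl fun i _ => ?_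
  rw [← ENNReal.ofReal_rpow_of_nonneg (norm_nonneg _) hp0.le, ofReal_norm, Lp.enorm_def,
    eLpNorm_congr_ae (hR _)]

lemma norm_pSum_rpow_ofSimpleFunc {E : Type*} [NormedAddCommGroup E] [NormedSpace ℝ E]
    [CompleteSpace E] {m : VectorMeasure Λ E} {k : ℕ} (s : Fin k → SimpleFunc Λ ℝ) :
    ‖LpSpace.pSum fun i => LpSpace.ofSimpleFunc m p (s i)‖ ^ (p : ℝ) =
      (eNormLp m 1 fun x => ∑ i, |s i x| ^ (p : ℝ)).toReal := by
  have hp0 := coe_pos_of_fact (p := p)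
  rw [LpSpace.norm_def, ENNReal.toReal_rpow, ← eNormLp_rpow (by exact_mod_cast hp0)]
  congr 1
  refine eNormLp_congr ?_
  filter_upwards [coeFn_pSum fun i => LpSpace.ofSimpleFunc m p (s i),
    ae_all_iff.2 fun i => LpSpace.coeFn_ofSimpleFunc (m := m) (p := p) (s i)] with x hx hx'
  have h1 : 0 ≤ ∑ i, |s i x| ^ (p : ℝ) := Finset.sum_nonneg fun i _ => by positivity
  simp only [hx, hx']
  rw [abs_of_nonneg (by positivity), ← Real.rpow_mul h1, one_div_mul_cancel hp0.ne', Real.rpow_one]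

/-- Maurey–Rosenthal factorization of `R ∘ I_m` through a space `L^p(κ)` with `κ` in the unit ball of
the dual of `L¹(m)`. -/
lemma exists_factorization_integrationMap {E Y : Type*} [NormedAddCommGroup E] [NormedSpace ℝ E]
    [CompleteSpace E] [NormedAddCommGroup Y] [NormedSpace ℝ Y] [CompleteSpace Y]
    {m : VectorMeasure Λ E} {R : E →L[ℝ] Y} {K : ℝ} (hK : 0 < K)
    (h : ∀ (k : ℕ) (f : Fin k → LpSpace m p),
      ∑ i, ‖R (integrationMap m p (f i))‖ ^ (p : ℝ) ≤ (K * ‖LpSpace.pSum f‖) ^ (p : ℝ)) :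
    ∃ κ : Measure Λ, IsFiniteMeasure κ ∧ (∀ f : Λ → ℝ, ∫⁻ x, ‖f x‖ₑ ∂κ ≤ eNormLp m 1 f) ∧
      (∃ i : LpSpace m p →L[ℝ] Lp ℝ p κ, (∀ f, i f =ᵐ[κ] f) ∧ ‖i‖ ≤ 1) ∧
      ∃ S : Lp ℝ p κ →L[ℝ] Y,
        (∀ (f : LpSpace m p) (g : Lp ℝ p κ), g =ᵐ[κ] f → S g = R (integrationMap m p f)) ∧
          ‖S‖ ≤ K := by
  have hp0 := coe_pos_of_fact (p := p)
  obtain ⟨κ, hκfin, hκ1, hκ⟩ := exists_measure_of_pSum_le (m := m) (p := p)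
    -- Dividing by `K` normalizes the constant to one, so that `κ` lands in the unit ball; `K`
    -- returns as the bound of `S`.
    (fun s => K⁻¹ • R (integrationMap m p (LpSpace.ofSimpleFunc m p s)))
    (fun c s => by rw [LpSpace.ofSimpleFunc_smul, map_smul, map_smul, smul_comm])
    (fun k s => by
      have h1 := h k fun i => LpSpace.ofSimpleFunc m p (s i)
      rw [Real.mul_rpow hK.le (norm_nonneg _), norm_pSum_rpow_ofSimpleFunc] at h1
      have h3 : 0 < K ^ (p : ℝ) := Real.rpow_pos_of_pos hK _
      simp only [norm_smul, norm_inv, Real.norm_of_nonneg hK.le]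
      simp only [Real.mul_rpow (inv_nonneg.2 hK.le) (norm_nonneg _), ← Finset.mul_sum,
        Real.inv_rpow hK.le]
      rw [inv_mul_le_iff₀ h3]
      exact h1)
  have hac := absolutelyContinuous_of_lintegral_le hκ1
  have hLp : ∀ f : Λ → ℝ, eLpNorm f p κ ≤ eNormLp m p f := fun f => by
    rw [← ENNReal.rpow_le_rpow_iff hp0, ← eLpNorm_one_abs_rpow,
      ← eNormLp_rpow (by exact_mod_cast hp0), ENNReal.coe_one, eLpNorm_one_eq_lintegral_enorm]
    exact hκ1 _
  obtain ⟨i, hi, hi1⟩ := exists_formalIdentity hac hLp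
  have hsimple : ∀ s : SimpleFunc Λ ℝ, ‖R (integral m s)‖ₑ ≤ K.toNNReal * eLpNorm s p κ :=
    fun s => by
      have h1 : integrationMap m p (LpSpace.ofSimpleFunc m p s) = integral m s :=
        (integral_congr (memL1_simpleFunc s) (LpSpace.coeFn_ofSimpleFunc s).symm).symm
      have h2 := hκ s
      simp only [h1, enorm_smul] at h2
      have h3 : (K.toNNReal : ℝ≥0∞) * ‖K⁻¹‖ₑ = 1 := by
        change ENNReal.ofReal K * _ = 1
        rw [Real.enorm_of_nonneg (inv_nonneg.2 hK.le), ← ENNReal.ofReal_mul hK.le,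
          mul_inv_cancel₀ hK.ne', ENNReal.ofReal_one]
      calc ‖R (integral m s)‖ₑ = K.toNNReal * (‖K⁻¹‖ₑ * ‖R (integral m s)‖ₑ) := by
            rw [← mul_assoc, h3, one_mul]
        _ ≤ _ := mul_le_mul_right h2 _
  have hbound : ∀ f : LpSpace m p,
      ‖(R.toLinearMap.comp (integrationMap m p)) f‖ ≤ K * ‖i.toLinearMap f‖ := fun f => by
    have hf := LpSpace.memLp f
    have h1 := enorm_apply_integral_le_of_simpleFunc one_le_of_fact hac hsimple hf
      ((hLp f).trans_lt (LpSpace.eNormLp_lt_top f))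
    rw [← eLpNorm_congr_ae (hi f), ← Lp.enorm_def] at h1
    change _ ≤ ENNReal.ofReal K * _ at h1
    rw [← ofReal_norm, ← ofReal_norm, ← ENNReal.ofReal_mul hK.le,
      ENNReal.ofReal_le_ofReal_iff (by positivity)] at h1
    exact h1
  -- By `hbound` the composite depends only on the class of `f` in `L^p(κ)`, so it extends by
  -- continuity from the dense range of `i`.
  have hdense : DenseRange i.toLinearMap := denseRange_of_coeFn_eq hac hi
  refine ⟨κ, hκfin, hκ1, ⟨i, hi, hi1⟩,
    (R.toLinearMap.comp (integrationMap m p)).extendOfNorm i.toLinearMap, fun f g hg => ?_,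
    ContinuousLinearMap.opNorm_le_bound _ hK.le
      (LinearMap.norm_extendOfNorm_apply_le hdense K hbound)⟩
  have hgi : g = i.toLinearMap f := Lp.ext (hg.trans (hi f).symm)
  rw [hgi, LinearMap.extendOfNorm_eq hdense ⟨K, hbound⟩]
  rfl

/-- Factorization of a `p`-regular integration map into `L^p(n)`, composed with the formal identity
`L^p(n) → L^p(κ')`. -/
lemma exists_factorization {Ω E : Type*} [MeasurableSpace Ω] [NormedAddCommGroup E]
    [NormedSpace ℝ E] [CompleteSpace E] {n : VectorMeasure Ω E}
    {m : VectorMeasure Λ (LpSpace n p)} {κ' : Measure Ω} (hκ' : κ' ≪ n.variation)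
    (hle : ∀ f : Ω → ℝ, eLpNorm f p κ' ≤ eNormLp n p f) {K : ℝ} (hK : 0 < K)
    (hreg : ∀ (k : ℕ) (f : Fin k → LpSpace m p),
      ‖LpSpace.pSum fun i => integrationMap m p (f i)‖ ≤ K * ‖LpSpace.pSum f‖) :
    ∃ κ : Measure Λ, IsFiniteMeasure κ ∧ (∀ f : Λ → ℝ, ∫⁻ x, ‖f x‖ₑ ∂κ ≤ eNormLp m 1 f) ∧
      (∃ i : LpSpace m p →L[ℝ] Lp ℝ p κ, (∀ f, i f =ᵐ[κ] f) ∧ ‖i‖ ≤ 1) ∧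
      ∃ S : Lp ℝ p κ →L[ℝ] Lp ℝ p κ',
        (∀ (f : LpSpace m p) (g : Lp ℝ p κ), g =ᵐ[κ] f → S g =ᵐ[κ'] integrationMap m p f) ∧
          ‖S‖ ≤ K := by
  obtain ⟨R, hR, -⟩ := exists_formalIdentity hκ' hle
  obtain ⟨κ, h1, h2, h3, S, hS, hSK⟩ := exists_factorization_integrationMap (m := m) (R := R) hK
    fun k f => (sum_rpow_norm_le hκ' hle hR _).trans
      (Real.rpow_le_rpow (norm_nonneg _) (hreg k f) p.coe_nonneg)
  refine ⟨κ, h1, h2, h3, S, fun f g hg => ?_, hSK⟩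
  rw [hS f g hg]
  exact hR _

end Factorization

/-! ### Densities in the Köthe dual -/

/-- A finite measure in the unit ball of the dual of `L¹(m)` has a density in the Köthe dual with
respect to any control measure. -/
lemma exists_weight_of_lintegral_le {Λ E : Type*} [MeasurableSpace Λ] [NormedAddCommGroup E]
    [NormedSpace ℝ E] {m : VectorMeasure Λ E} {ν : Measure Λ}
    (hν : IsControlMeasure m ν) {κ : Measure Λ} [IsFiniteMeasure κ]
    (hκ : ∀ f : Λ → ℝ, ∫⁻ x, ‖f x‖ₑ ∂κ ≤ eNormLp m 1 f) :
    ∃ w : Λ →₁[ν] ℝ, 0 ≤ w ∧ weighted ν w = κ ∧ (w : Λ →ₘ[ν] ℝ) ∈ kotheDualBall m ν := by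
  have := hν.1
  -- All measurable subsets of a `ν`-null set are `ν`-null, so `m` vanishes on each of them and the
  -- variation is zero.
  have hmν : m.variation ≪ ν := by
    refine Measure.AbsolutelyContinuous.mk fun A hA h0 => ?_
    rw [VectorMeasure.variation_apply_eq_zero hA]
    exact fun t hts ht => hν.2 t ht (measure_mono_null hts h0)
  have hκν : κ ≪ ν := (absolutelyContinuous_of_lintegral_le hκ).trans hmν
  have hint : Integrable (fun x => (κ.rnDeriv ν x).toReal) ν := Measure.integrable_toReal_rnDeriv
  have hw := hint.coeFn_toL1
  refine ⟨hint.toL1 _, ?_, ?_, fun f hfm hf => ?_⟩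
  · rw [← Lp.coeFn_nonneg]
    filter_upwards [hw] with x hx
    rw [hx]
    exact ENNReal.toReal_nonneg
  -- The derivative is finite almost everywhere, so passing to a real-valued weight and back loses
  -- nothing.
  · refine (withDensity_congr_ae ?_).trans (Measure.withDensity_rnDeriv_eq κ ν hκν)
    filter_upwards [hw, Measure.rnDeriv_lt_top κ ν] with x hx hx'
    rw [hx, ENNReal.ofReal_toReal hx'.ne]
  · have hfκ : Integrable f κ := ⟨hfm.aestronglyMeasurable, (hκ f).trans_lt hf.eNormLp_lt_top⟩
    have hae : (fun x => (κ.rnDeriv ν x).toReal • f x) =ᵐ[ν] fun x => f x * hint.toL1 _ x := by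
      filter_upwards [hw] with x hx
      rw [hx, smul_eq_mul, mul_comm]
    refine ⟨((integrable_rnDeriv_smul_iff hκν).2 hfκ).congr hae, fun h1 => ?_⟩
    rw [← MeasureTheory.integral_congr_ae hae, integral_rnDeriv_smul hκν]
    refine (le_abs_self _).trans ((norm_integral_le_lintegral_norm f).trans ?_)
    refine ENNReal.toReal_le_of_le_ofReal zero_le_one ?_
    simp only [ofReal_norm, ENNReal.ofReal_one]
    exact (hκ f).trans h1

/-! ### Conjugate families of weights and `p`-regularity -/

section ConjugateFamily

variable {Ω Λ E F : Type*} [MeasurableSpace Ω] [MeasurableSpace Λ] [NormedAddCommGroup E]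
  [NormedSpace ℝ E] [CompleteSpace E] [NormedAddCommGroup F] [NormedSpace ℝ F] [CompleteSpace F]
  {n : VectorMeasure Ω F} {p : ℝ≥0} [Fact (1 ≤ (p : ℝ≥0∞))] {μ : Measure Ω} {ν : Measure Λ}
  {V : Set (Ω →₁[μ] ℝ)}

/-- An operator into `L^p(n)` that factors, uniformly in `v ∈ V`, through spaces `L^p(w dν)` is
bounded on finite families. -/
lemma eNormLp_pSum_le_of_isConjugateFamily {m : VectorMeasure Λ E}
    {T : LpSpace m p →ₗ[ℝ] LpSpace n p} {W : Set (Λ →₁[ν] ℝ)}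
    (hac : ∀ v ∈ V, weighted μ v ≪ n.variation)
    (hge : ∀ (f : LpSpace n p) (c : ℝ≥0∞), (∀ v ∈ V, eLpNorm f p (weighted μ v) ≤ c) →
      eNormLp n p f ≤ 2 * c)
    (h : IsConjugateFamily T ν μ V W) :
    ∃ D : ℝ≥0, ∀ (k : ℕ) (f : Fin k → LpSpace m p),
      eNormLp n p (LpSpace.pSum fun i => T (f i)) ≤
        2 * (D * (D * eNormLp m p (LpSpace.pSum f))) := by
  obtain ⟨-, C, hW, hS⟩ := h
  refine ⟨C.toNNReal, fun k f => ?_⟩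
  obtain ⟨D, hD⟩ : ∃ D : ℝ≥0, D = C.toNNReal := ⟨_, rfl⟩
  rw [← hD]
  -- One factor `D` comes from `S`, applied to each `f j` and summed inside scalar `L^p` spaces; the
  -- other from the formal identity, applied to the p-sum as a single function.
  have key : ∀ v ∈ V, eLpNorm (LpSpace.pSum fun i => T (f i)) p (weighted μ v) ≤
      D * (D * eNormLp m p (LpSpace.pSum f)) := fun v hv => by
    obtain ⟨w, hw, S, hST, hSC⟩ := hS v hv
    obtain ⟨hacw, i, hi, hiC⟩ := hW w hw
    have hT : ∀ j, eLpNorm (T (f j)) p (weighted μ v) ≤ D * eLpNorm (f j) p (weighted ν w) := by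
      intro j
      rw [← eLpNorm_congr_ae (hST (f j) (i (f j)) (hi _)), ← eLpNorm_congr_ae (hi (f j)),
        ← Lp.enorm_def, ← Lp.enorm_def, hD]
      exact enorm_apply_le_of_opNorm_le hSC _
    have hF : eLpNorm (LpSpace.pSum f) p (weighted ν w) ≤ D * eNormLp m p (LpSpace.pSum f) := by
      rw [← eLpNorm_congr_ae (hi (LpSpace.pSum f)), ← Lp.enorm_def, hD]
      refine (enorm_apply_le_of_opNorm_le hiC (LpSpace.pSum f)).trans_eq ?_
      rw [LpSpace.enorm_def]
    exact (eLpNorm_pSum_le hacw (hac v hv) hT).trans (mul_le_mul_right hF _)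
  exact hge _ _ key

/-- An operator into `L^p(n)` that factors, uniformly in `v ∈ V`, through spaces `L^p(w dν)` is
`p`-regular. -/
lemma isPRegular_of_isConjugateFamily {m : VectorMeasure Λ E}
    {T : LpSpace m p →ₗ[ℝ] LpSpace n p} {W : Set (Λ →₁[ν] ℝ)}
    (hac : ∀ v ∈ V, weighted μ v ≪ n.variation)
    (hge : ∀ (f : LpSpace n p) (c : ℝ≥0∞), (∀ v ∈ V, eLpNorm f p (weighted μ v) ≤ c) →
      eNormLp n p f ≤ 2 * c)
    (h : IsConjugateFamily T ν μ V W) : IsPRegular T := by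
  obtain ⟨D, hD⟩ := eNormLp_pSum_le_of_isConjugateFamily hac hge h
  -- The summand `1` only keeps the constant positive when `D = 0`.
  refine ⟨2 * (D * D) + 1, by positivity, fun k f => ?_⟩
  rw [LpSpace.norm_def, LpSpace.norm_def]
  have hfin := (LpSpace.eNormLp_lt_top (LpSpace.pSum f)).ne
  have h2 := ENNReal.toReal_mono (by finiteness) (hD k f)
  simp only [ENNReal.toReal_mul, ENNReal.coe_toReal, ENNReal.toReal_ofNat] at h2
  have h3 := ENNReal.toReal_nonneg (a := eNormLp m p (LpSpace.pSum f))
  linarith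

/-- A `p`-regular integration map into `L^p(n)` has a conjugate family of weights in the unit ball of
the Köthe dual. -/
lemma exists_isConjugateFamily {m : VectorMeasure Λ (LpSpace n p)}
    (hac : ∀ v ∈ V, weighted μ v ≪ n.variation)
    (hle : ∀ v ∈ V, ∀ f : Ω → ℝ, eLpNorm f p (weighted μ v) ≤ eNormLp n p f)
    (hν : IsControlMeasure m ν) (h : IsPRegular (integrationMap m p)) :
    ∃ W : Set (Λ →₁[ν] ℝ), (∀ w ∈ W, (w : Λ →ₘ[ν] ℝ) ∈ kotheDualBall m ν) ∧
      IsConjugateFamily (integrationMap m p) ν μ V W := by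
  obtain ⟨K, hK, hreg⟩ := h
  have key : ∀ v : V, ∃ w : Λ →₁[ν] ℝ, 0 ≤ w ∧ (w : Λ →ₘ[ν] ℝ) ∈ kotheDualBall m ν ∧
      weighted ν w ≪ m.variation ∧
      (∃ i : LpSpace m p →L[ℝ] Lp ℝ p (weighted ν w), (∀ f, i f =ᵐ[weighted ν w] f) ∧ ‖i‖ ≤ 1) ∧
      ∃ S : Lp ℝ p (weighted ν w) →L[ℝ] Lp ℝ p (weighted μ v.1),
        (∀ (f : LpSpace m p) (g : Lp ℝ p (weighted ν w)), g =ᵐ[weighted ν w] f →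
          S g =ᵐ[weighted μ v.1] integrationMap m p f) ∧ ‖S‖ ≤ K := by
    intro v
    obtain ⟨κ, hκfin, hκ, hi, hS⟩ := exists_factorization (hac v v.2) (hle v v.2) hK hreg
    obtain ⟨w, hw0, rfl, hw⟩ := exists_weight_of_lintegral_le hν hκ
    exact ⟨w, hw0, hw, absolutelyContinuous_of_lintegral_le hκ, hi, hS⟩
  choose w hw0 hwball hwac hi hS using key
  -- One weight per `v`: the formal identities are bounded by `1` and the induced operators by `K`,
  -- uniformly in `v`.
  refine ⟨Set.range w, Set.forall_mem_range.2 hwball, Set.forall_mem_range.2 hw0, max 1 K,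
    Set.forall_mem_range.2 fun v => ⟨hwac v, ?_⟩, fun v hv => ⟨w ⟨v, hv⟩, ⟨_, rfl⟩, ?_⟩⟩
  · obtain ⟨i, hi, hi1⟩ := hi v
    exact ⟨i, hi, hi1.trans (le_max_left _ _)⟩
  · obtain ⟨S, hS, hSK⟩ := hS ⟨v, hv⟩
    exact ⟨S, hS, hSK.trans (le_max_right _ _)⟩

/-- For a vector measure `n` whose `L^p`-norm is equivalent to the supremum of the `L^p`-norms over
the weights in `V`, an integration map into `L^p(n)` is `p`-regular iff there is a conjugate family
of weights in the unit ball of the Köthe dual. -/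
theorem isPRegular_integrationMap_iff {m : VectorMeasure Λ (LpSpace n p)}
    (hac : ∀ v ∈ V, weighted μ v ≪ n.variation)
    (hle : ∀ v ∈ V, ∀ f : Ω → ℝ, eLpNorm f p (weighted μ v) ≤ eNormLp n p f)
    (hge : ∀ (f : LpSpace n p) (c : ℝ≥0∞), (∀ v ∈ V, eLpNorm f p (weighted μ v) ≤ c) →
      eNormLp n p f ≤ 2 * c)
    (hν : IsControlMeasure m ν) :
    IsPRegular (integrationMap m p) ↔
      ∃ W : Set (Λ →₁[ν] ℝ), (∀ w ∈ W, (w : Λ →ₘ[ν] ℝ) ∈ kotheDualBall m ν) ∧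
        IsConjugateFamily (integrationMap m p) ν μ V W :=
  ⟨exists_isConjugateFamily hac hle hν,
    fun ⟨_, _, hW⟩ => isPRegular_of_isConjugateFamily hac hge hW⟩

end ConjugateFamily

end VectorLp

/-- All that is needed of `m_V` is that the supremum over `V` of the norms of `L^p(v dμ)` lies
between half the norm of `L^p(m_V)` and that norm, and that `m_V`-null sets are null for every `v
dμ`. -/
theorem mainTheorem1 {Ω Λ : Type*} [MeasurableSpace Ω] [MeasurableSpace Λ]
    (p : NNReal) [Fact (1 ≤ (p : ENNReal))]
    (μ : MeasureTheory.Measure Ω) [MeasureTheory.IsFiniteMeasure μ]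
    (V : Set (MeasureTheory.Lp ℝ 1 μ)) (hpos : ∀ v ∈ V, 0 ≤ v)
    (hV : VectorLp.IsRelWeaklyCompact V)
    (m : MeasureTheory.VectorMeasure Λ
      (VectorLp.LpSpace (VectorLp.weightMeasure μ V hpos hV) p))
    (ν : MeasureTheory.Measure Λ) (hν : VectorLp.IsControlMeasure m ν) :
    VectorLp.IsPRegular (VectorLp.integrationMap m p) ↔
      ∃ W : Set (MeasureTheory.Lp ℝ 1 ν),
        (∀ w ∈ W, (w : MeasureTheory.AEEqFun Λ ℝ ν) ∈ VectorLp.kotheDualBall m ν) ∧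
        VectorLp.IsConjugateFamily (VectorLp.integrationMap m p) ν μ V W :=
  VectorLp.isPRegular_integrationMap_iff
    (fun v hv => VectorLp.weighted_ac ⟨v, hv⟩)
    (fun v hv => VectorLp.eLpNorm_weighted_le ⟨v, hv⟩)
    (fun f _ hc => VectorLp.eNormLp_weightMeasure_le VectorLp.one_le_of_fact
      (VectorLp.LpSpace.memLp f) hc) hν
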